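/- Let $\Gamma(t)=(\xi(t),\eta(t))$ be a regular $C^2$ closed plane curve, i.e. $\Gamma\in C^2(\mathbb R,\mathbb R^2)$ is periodic with some period $L>0$ and $\Gamma'(t)\ne 0$ for all $t$. Assume that $\Gamma$ is star-shaped: there is a point $z_0$ such that every ray issuing from $z_0$ meets the curve exactly once (for exactly one parameter value $t\in[0,L)$). For $R>0$ let $\theta_R(\cdot,\theta_0)$ be the solution of the bicycle equation $$\theta'=\frac1R\bigl(\xi'(t)\sin\theta-\eta'(t)\cos\theta\bigr),\qquad \theta(0)=\theta_0 ,$$ let $\mathcal P_R(\theta_0)=\theta_R(L,\theta_0)$ be its Poincaré map, let $$\rho_\Gamma(R)=\lim_{n\to\infty}\frac{1}{2\pi}\,\frac{\mathcal P_R^n(\theta_0)-\theta_0}{n}$$ be its rotation number (which does not depend on $\theta_0$), and let $\mathcal M_R:S^1\to S^1$, $\mathcal M_R(e^{i\theta_0})=e^{i\mathcal P_R(\theta_0)}$, be the bicycle monodromy map. Let $$\omega(\Gamma)=\frac1{2\pi}\int_0^L\frac{\xi'\eta''-\eta'\xi''}{\xi'^2+\eta'^2}\,dt$$ be the rotation index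 of $\Gamma$, and let $$\underline R(\Gamma)=\sup\{R_*>0:\ \rho_\Gamma(R)=\omega(\Gamma)\text{ for all }R\in(0,R_*]\}$$ be the critical B-length. Call a Möbius map of $S^1$, $z\mapsto (az+b)/(\bar b z+\bar a)$ with $|a|^2-|b|^2=1$, hyperbolic if it has exactly two fixed points on $S^1$, and elliptic if it has no fixed point on $S^1$. Then the set defining $\underline R(\Gamma)$ is non-empty and bounded above, so that $\underline R(\Gamma)\in(0,\infty)$; for every $0<R<\underline R(\Gamma)$ the map $\mathcal M_R$ is a hyperbolic Möbius map, and for every $R>\underline R(\Gamma)$ it is an elliptic Möbius map. -/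

import Mathlib

/-- A regular `C²` closed plane curve: a periodic `C²` parametrization `Γ : ℝ → ℝ²` with nowhere
vanishing velocity and period `L > 0`. The plane `ℝ²` is identified with `ℂ`,
`Γ(t) = ξ(t) + i η(t)`. -/
structure RegularClosedCurve where
  toFun : ℝ → ℂ
  period : ℝ
  period_pos : 0 < period
  contDiff : ContDiff ℝ 2 toFun
  periodic : Function.Periodic toFun period
  regular : ∀ t, deriv toFun t ≠ 0

namespace RegularClosedCurve

open Filter Topology

/-- Star-shaped: for some centre `z₀`, every ray `{z₀ + s u : s ≥ 0}`, `‖u‖ = 1`, meets the curve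
exactly once, i.e. for exactly one parameter value in one period. -/
def IsStarShaped (Γ : RegularClosedCurve) : Prop :=
  ∃ z₀ : ℂ, ∀ u : Circle, ∃! t : ℝ, t ∈ Set.Ico 0 Γ.period ∧
    ∃ s : ℝ, 0 ≤ s ∧ Γ.toFun t = z₀ + (s : ℂ) * (u : ℂ)

/-- The rotation index `ω(Γ) = (1/2π) ∫₀ᴸ ψ'(t) dt`, where `ψ` is a continuous argument of `Γ'`, so
that `ψ' = (ξ' η'' - η' ξ'') / (ξ'² + η'²)` (curvature times speed). -/
noncomputable def rotationIndex (Γ : RegularClosedCurve) : ℝ :=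
  (1 / (2 * Real.pi)) * ∫ t in (0 : ℝ)..Γ.period,
    ((deriv Γ.toFun t).re * (deriv (deriv Γ.toFun) t).im
      - (deriv Γ.toFun t).im * (deriv (deriv Γ.toFun) t).re)
      / ((deriv Γ.toFun t).re ^ 2 + (deriv Γ.toFun t).im ^ 2)

/-- The right-hand side of the bicycle equation
`θ' = (1/R) (ξ'(t) sin θ - η'(t) cos θ)`. -/
noncomputable def field (Γ : RegularClosedCurve) (R t θ : ℝ) : ℝ :=
  (1 / R) * ((deriv Γ.toFun t).re * Real.sin θ - (deriv Γ.toFun t).im * Real.cos θ)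

theorem contDiff_deriv (Γ : RegularClosedCurve) : ContDiff ℝ 1 (deriv Γ.toFun) := by
  have h : ContDiff ℝ (1 + 1) Γ.toFun := by
    have := Γ.contDiff
    norm_num
    exact this
  exact (contDiff_succ_iff_deriv.1 h).2.2

theorem periodic_deriv (Γ : RegularClosedCurve) :
    Function.Periodic (deriv Γ.toFun) Γ.period := by
  intro t
  rw [← deriv_comp_add_const]
  congr 1
  funext s
  exact Γ.periodic s

theorem field_add_period (Γ : RegularClosedCurve) (R t θ : ℝ) :
    Γ.field R (t + Γ.period) θ = Γ.field R t θ := by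
  simp only [field, Γ.periodic_deriv t]

theorem field_add_two_pi (Γ : RegularClosedCurve) (R t θ : ℝ) (k : ℤ) :
    Γ.field R t (θ + k * (2 * Real.pi)) = Γ.field R t θ := by
  simp only [field, Real.sin_add_int_mul_two_pi, Real.cos_add_int_mul_two_pi]

theorem continuous_field (Γ : RegularClosedCurve) (R θ : ℝ) :
    Continuous (fun t => Γ.field R t θ) := by
  have h := Γ.contDiff_deriv.continuous
  unfold field
  fun_prop

theorem exists_bound (Γ : RegularClosedCurve) (R : ℝ) :
    ∃ K : NNReal, (∀ t, LipschitzWith K (Γ.field R t)) ∧ ∀ t θ, ‖Γ.field R t θ‖ ≤ K := by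
  obtain ⟨C, hC⟩ := (isCompact_Icc (a := (0 : ℝ)) (b := 0 + Γ.period)).exists_bound_of_continuousOn
    Γ.contDiff_deriv.continuous.continuousOn
  have hC' : ∀ t, ‖deriv Γ.toFun t‖ ≤ C := by
    intro t
    obtain ⟨s, hs, hst⟩ := Γ.periodic_deriv.exists_mem_Ico₀ Γ.period_pos t
    rw [hst]
    exact hC s ⟨hs.1, by linarith [hs.2]⟩
  have hC0 : 0 ≤ C := (norm_nonneg _).trans (hC' 0)
  have hre : ∀ t, |(deriv Γ.toFun t).re| ≤ C := fun t => (Complex.abs_re_le_norm _).trans (hC' t)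
  have him : ∀ t, |(deriv Γ.toFun t).im| ≤ C := fun t => (Complex.abs_im_le_norm _).trans (hC' t)
  have hK : 0 ≤ |1 / R| * (C + C) := by positivity
  refine ⟨Real.toNNReal (|1 / R| * (C + C)), fun t => LipschitzWith.of_dist_le_mul fun x y => ?_,
    fun t θ => ?_⟩
  · have hs : |Real.sin x - Real.sin y| ≤ |x - y| := by
      simpa [Real.dist_eq] using Real.lipschitzWith_sin.dist_le_mul x y
    have hc : |Real.cos x - Real.cos y| ≤ |x - y| := by
      simpa [Real.dist_eq] using Real.lipschitzWith_cos.dist_le_mul x y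
    have e : Γ.field R t x - Γ.field R t y = (1 / R) *
        ((deriv Γ.toFun t).re * (Real.sin x - Real.sin y)
          - (deriv Γ.toFun t).im * (Real.cos x - Real.cos y)) := by
      simp only [field]; ring
    rw [Real.dist_eq, Real.dist_eq, e, abs_mul, Real.coe_toNNReal _ hK, mul_assoc]
    refine mul_le_mul_of_nonneg_left ((abs_sub _ _).trans ?_) (abs_nonneg _)
    rw [abs_mul, abs_mul, add_mul]
    exact add_le_add (mul_le_mul (hre t) hs (abs_nonneg _) hC0)
      (mul_le_mul (him t) hc (abs_nonneg _) hC0)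
  · rw [Real.norm_eq_abs, field, abs_mul, Real.coe_toNNReal _ hK]
    refine mul_le_mul_of_nonneg_left ((abs_sub _ _).trans ?_) (abs_nonneg _)
    rw [abs_mul, abs_mul]
    refine add_le_add ?_ ?_
    · simpa using mul_le_mul (hre t) (Real.abs_sin_le_one θ) (abs_nonneg _) hC0
    · simpa using mul_le_mul (him t) (Real.abs_cos_le_one θ) (abs_nonneg _) hC0

/-- Solutions of the bicycle equation with equal values at one time coincide. -/
theorem integralCurve_unique (Γ : RegularClosedCurve) (R : ℝ) {α β : ℝ → ℝ} {t₀ : ℝ}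
    (hα : IsIntegralCurve α (Γ.field R)) (hβ : IsIntegralCurve β (Γ.field R))
    (h : α t₀ = β t₀) : α = β := by
  obtain ⟨K, hK, -⟩ := Γ.exists_bound R
  exact ODE_solution_unique_univ (s := fun _ => Set.univ) (fun t => (hK t).lipschitzOnWith)
    (fun t => ⟨hα t, trivial⟩) (fun t => ⟨hβ t, trivial⟩) h

/-- Every initial value problem for the bicycle equation has a global solution. -/
theorem exists_integralCurve (Γ : RegularClosedCurve) (R θ₀ : ℝ) :
    ∃ θ : ℝ → ℝ, θ 0 = θ₀ ∧ IsIntegralCurve θ (Γ.field R) := by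
  obtain ⟨K, hK, hb⟩ := Γ.exists_bound R
  have hex : ∀ n : ℕ, ∃ α : ℝ → ℝ, α 0 = θ₀ ∧
      ∀ t ∈ Set.Ioo (-((n : ℝ) + 1)) ((n : ℝ) + 1), HasDerivAt α (Γ.field R t (α t)) t := by
    intro n
    have hn : (0 : ℝ) < (n : ℝ) + 1 := by positivity
    have hP : IsPicardLindelof (Γ.field R) (tmin := -((n : ℝ) + 1)) (tmax := (n : ℝ) + 1)
        ⟨0, by constructor <;> linarith⟩ θ₀ (K * (n + 1)) 0 K K :=
      { lipschitzOnWith := fun t _ => (hK t).lipschitzOnWith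
        continuousOn := fun x _ => (Γ.continuous_field R x).continuousOn
        norm_le := fun t _ x _ => hb t x
        mul_max_le := by simp }
    obtain ⟨α, h0, h1⟩ := hP.exists_eq_forall_mem_Icc_hasDerivWithinAt₀
    exact ⟨α, h0, fun t ht =>
      (h1 t (Set.Ioo_subset_Icc_self ht)).hasDerivAt (Icc_mem_nhds ht.1 ht.2)⟩
  choose α h0 h1 using hex
  have hagree : ∀ m n : ℕ, m ≤ n →
      Set.EqOn (α m) (α n) (Set.Ioo (-((m : ℝ) + 1)) ((m : ℝ) + 1)) := by
    intro m n hmn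
    have hmn' : (m : ℝ) ≤ n := by exact_mod_cast hmn
    have hm : (0 : ℝ) < (m : ℝ) + 1 := by positivity
    refine ODE_solution_unique_of_mem_Ioo (v := Γ.field R) (s := fun _ => Set.univ) (K := K)
      (t₀ := 0) (fun t _ => (hK t).lipschitzOnWith) ⟨by linarith, hm⟩
      (fun t ht => ⟨h1 m t ht, trivial⟩)
      (fun t ht => ⟨h1 n t ⟨by linarith [ht.1], by linarith [ht.2]⟩, trivial⟩) ?_
    rw [h0, h0]
  refine ⟨fun t => α ⌈|t|⌉₊ t, by simpa using h0 _, fun t => ?_⟩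
  set N : ℕ := ⌈|t|⌉₊ + 1 with hN
  have htN : |t| < N := by
    have := Nat.le_ceil |t|
    rw [hN]; push_cast; linarith
  have key : ∀ s : ℝ, |s| < N → α ⌈|s|⌉₊ s = α N s := by
    intro s hs
    refine hagree _ _ (Nat.ceil_le.2 hs.le) ?_
    have := Nat.le_ceil |s|
    exact abs_lt.1 (by linarith)
  have hev : (fun s => α ⌈|s|⌉₊ s) =ᶠ[𝓝 t] α N := by
    filter_upwards [(isOpen_lt continuous_abs continuous_const).mem_nhds htN] with s hs
    exact key s hs
  have hd := h1 N t (abs_lt.1 (by linarith))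
  simp only [key t htN]
  exact hd.congr_of_eventuallyEq hev

/-- The solution `t ↦ θ_R(t, θ₀)` of the bicycle equation with `θ_R(0, θ₀) = θ₀`. -/
noncomputable def angle (Γ : RegularClosedCurve) (R θ₀ : ℝ) : ℝ → ℝ :=
  Classical.choose (Γ.exists_integralCurve R θ₀)

theorem angle_zero (Γ : RegularClosedCurve) (R θ₀ : ℝ) : Γ.angle R θ₀ 0 = θ₀ :=
  (Classical.choose_spec (Γ.exists_integralCurve R θ₀)).1

theorem angle_isIntegralCurve (Γ : RegularClosedCurve) (R θ₀ : ℝ) :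
    IsIntegralCurve (Γ.angle R θ₀) (Γ.field R) :=
  (Classical.choose_spec (Γ.exists_integralCurve R θ₀)).2

/-- The Poincaré map `𝓟_R : θ₀ ↦ θ_R(L, θ₀)`. -/
noncomputable def poincare (Γ : RegularClosedCurve) (R θ₀ : ℝ) : ℝ :=
  Γ.angle R θ₀ Γ.period

theorem angle_add_two_pi (Γ : RegularClosedCurve) (R θ₀ t : ℝ) (k : ℤ) :
    Γ.angle R (θ₀ + k * (2 * Real.pi)) t = Γ.angle R θ₀ t + k * (2 * Real.pi) := by
  have h : IsIntegralCurve (fun t => Γ.angle R θ₀ t + k * (2 * Real.pi)) (Γ.field R) := by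
    intro s
    rw [field_add_two_pi]
    exact (Γ.angle_isIntegralCurve R θ₀ s).add_const _
  exact congrFun (Γ.integralCurve_unique R (Γ.angle_isIntegralCurve R _) h (t₀ := 0)
    (by simp only [angle_zero])) t

theorem angle_mono (Γ : RegularClosedCurve) (R t : ℝ) :
    Monotone (fun θ₀ => Γ.angle R θ₀ t) := by
  intro x y hxy
  by_contra hlt
  simp only [not_le] at hlt
  have hc : Continuous (fun s => Γ.angle R y s - Γ.angle R x s) := by
    have h1 : ∀ z, Continuous (Γ.angle R z) := fun z =>
      continuous_iff_continuousAt.2 fun s => (Γ.angle_isIntegralCurve R z s).continuousAt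
    exact (h1 y).sub (h1 x)
  have hm : (0 : ℝ) ∈ Set.uIcc (Γ.angle R y t - Γ.angle R x t)
      (Γ.angle R y 0 - Γ.angle R x 0) := by
    simp only [angle_zero]
    rw [Set.uIcc_of_le (by linarith)]
    constructor <;> linarith
  obtain ⟨s, -, hs⟩ := intermediate_value_uIcc hc.continuousOn hm
  have := Γ.integralCurve_unique R (Γ.angle_isIntegralCurve R y) (Γ.angle_isIntegralCurve R x)
    (sub_eq_zero.1 hs)
  rw [this] at hlt
  exact lt_irrefl _ hlt

/-- The rotation number `ρ_Γ(R) = lim (1/2π) (𝓟_Rⁿ(θ₀) - θ₀) / n`; the limit exists and does not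
depend on `θ₀`, see `tendsto_rotationNumber`. -/
noncomputable def rotationNumber (Γ : RegularClosedCurve) (R : ℝ) : ℝ :=
  limUnder atTop fun n : ℕ => (1 / (2 * Real.pi)) * (((Γ.poincare R)^[n] 0 - 0) / n)

/-- The Poincaré map in the normalized angle `x = θ / 2π`. -/
noncomputable def poincareLift (Γ : RegularClosedCurve) (R : ℝ) : CircleDeg1Lift where
  toFun x := Γ.poincare R (2 * Real.pi * x) / (2 * Real.pi)
  monotone' := by
    intro x y hxy
    have h2 : 2 * Real.pi * x ≤ 2 * Real.pi * y :=
      mul_le_mul_of_nonneg_left hxy Real.two_pi_pos.le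
    exact div_le_div_of_nonneg_right (Γ.angle_mono R Γ.period h2) Real.two_pi_pos.le
  map_add_one' := by
    intro x
    have h := Γ.angle_add_two_pi R (2 * Real.pi * x) Γ.period 1
    have e : 2 * Real.pi * (x + 1) = 2 * Real.pi * x + ((1 : ℤ) : ℝ) * (2 * Real.pi) := by
      push_cast; ring
    simp only [poincare]
    rw [e, h, add_div]
    simp [Real.pi_ne_zero]

theorem poincareLift_iterate (Γ : RegularClosedCurve) (R x : ℝ) (n : ℕ) :
    ((Γ.poincareLift R) ^ n) x = (Γ.poincare R)^[n] (2 * Real.pi * x) / (2 * Real.pi) := by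
  induction n with
  | zero => simp [Real.pi_ne_zero]
  | succ n ih =>
    rw [pow_succ', CircleDeg1Lift.mul_apply, ih, Function.iterate_succ_apply']
    change Γ.poincare R (2 * Real.pi * (_ / (2 * Real.pi))) / (2 * Real.pi) = _
    rw [mul_div_cancel₀ _ Real.two_pi_pos.ne']

theorem tendsto_translationNumber (Γ : RegularClosedCurve) (R θ₀ : ℝ) :
    Tendsto (fun n : ℕ => (1 / (2 * Real.pi)) * (((Γ.poincare R)^[n] θ₀ - θ₀) / n)) atTop
      (𝓝 (Γ.poincareLift R).translationNumber) := by
  refine ((Γ.poincareLift R).tendsto_translationNumber (θ₀ / (2 * Real.pi))).congr fun n => ?_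
  rw [poincareLift_iterate, mul_div_cancel₀ _ Real.two_pi_pos.ne']
  ring

theorem tendsto_rotationNumber (Γ : RegularClosedCurve) (R θ₀ : ℝ) :
    Tendsto (fun n : ℕ => (1 / (2 * Real.pi)) * (((Γ.poincare R)^[n] θ₀ - θ₀) / n)) atTop
      (𝓝 (Γ.rotationNumber R)) := by
  have h : Γ.rotationNumber R = (Γ.poincareLift R).translationNumber :=
    (Γ.tendsto_translationNumber R 0).limUnder_eq
  rw [h]
  exact Γ.tendsto_translationNumber R θ₀

/-- The set `{R* > 0 : ρ_Γ(R) = ω(Γ) for all R ∈ (0, R*]}`. -/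
def firstPlateau (Γ : RegularClosedCurve) : Set ℝ :=
  {Rs : ℝ | 0 < Rs ∧ ∀ R ∈ Set.Ioc 0 Rs, Γ.rotationNumber R = Γ.rotationIndex}

/-- The critical B-length `R̲(Γ)`, the right end of the first plateau of `ρ_Γ`. -/
noncomputable def criticalBLength (Γ : RegularClosedCurve) : ℝ :=
  sSup Γ.firstPlateau

/-- The bicycle monodromy map `𝓜_R : S¹ → S¹`, `e^{iθ₀} ↦ e^{iθ_R(L, θ₀)}`. It does not depend on the
chosen argument, see `monodromy_exp`. -/
noncomputable def monodromy (Γ : RegularClosedCurve) (R : ℝ) (z : Circle) : Circle :=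
  Circle.exp (Γ.poincare R (Complex.arg (z : ℂ)))

theorem monodromy_exp (Γ : RegularClosedCurve) (R θ₀ : ℝ) :
    Γ.monodromy R (Circle.exp θ₀) = Circle.exp (Γ.poincare R θ₀) := by
  have h : Circle.exp (Complex.arg (Circle.exp θ₀ : ℂ)) = Circle.exp θ₀ := Circle.exp_arg _
  obtain ⟨m, hm⟩ := Circle.exp_eq_exp.1 h
  rw [monodromy, hm]
  simp only [poincare]
  rw [angle_add_two_pi]
  exact Circle.exp_eq_exp.2 ⟨m, rfl⟩

end RegularClosedCurve

/-- `f` is a Möbius transformation of the circle, induced by a matrix of `SU(1,1)`: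
`f(z) = (a z + b) / (b̄ z + ā)` with `|a|² - |b|² = 1`. -/
def IsCircleMoebius (f : Circle → Circle) : Prop :=
  ∃ a b : ℂ, ‖a‖ ^ 2 - ‖b‖ ^ 2 = 1 ∧
    ∀ z : Circle, (f z : ℂ) = (a * z + b) / (starRingEnd ℂ b * z + starRingEnd ℂ a)

/-- A hyperbolic Möbius transformation of the circle: exactly two fixed points on `S¹`. -/
def IsHyperbolic (f : Circle → Circle) : Prop :=
  IsCircleMoebius f ∧ (Function.fixedPoints f).encard = 2

/-- An elliptic Möbius transformation of the circle: no fixed point on `S¹`. -/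
def IsElliptic (f : Circle → Circle) : Prop :=
  IsCircleMoebius f ∧ Function.fixedPoints f = ∅

/-!
# Monodromy of the bicycle equation on a star-shaped curve

Let `Γ = z₀ + r e^{iφ}` in polar coordinates about the centre. Being star-shaped means that `φ` is
strictly monotone and makes one turn per period (`IsStarShaped.exists_polarCoords`); let `sgn = ±1`
be its direction. Comparing the velocity with the radius vector gives `ω(Γ) = sgn`
(`PolarCoords.rotationIndex_eq`).

The bicycle equation describes a hyperbolic plane of curvature `-1 / R²` rolling along `Γ`, acting on
its circle at infinity. Translating the point at distance `r / R` in the direction `φ` back to the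
centre (`boost`, `PolarCoords.centred`) turns the equation into `y' = φ' G(r / R, cos (y - φ))` with
`∂G/∂k (k, c) = k (cosh k - c sinh k) > 0` for `k > 0` and `|c| ≤ 1` (`centredSpeed_strictMonoOn`).
Since `sgn * φ' ≥ 0`, decreasing `R` strictly increases the advance, counted in the direction of
`sgn`, of every centred angle over one period (`PolarCoords.centred_lt_centred`). At time `0` and at
the end of the period the centring map is the same and commutes with full turns, so comparisons of
the advance with multiples of `2π` carry over to the Poincaré map (`PolarCoords.advance_lt`).

Three facts follow. Comparison with `R = ∞` shows that the advance is positive for every `R > 0`. By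
the theory of translation numbers `ρ_Γ(R) = ω(Γ)` holds exactly when some solution advances by `2π`;
this happens for small `R`, by a trapping region around the direction opposite to the velocity
(`PolarCoords.exists_turn_of_small`), and not for large `R` (`exists_small_advance_of_large`). Inside
the plateau, comparison with a larger and with a smaller `R` gives advances both above and below `2π`,
hence two fixed points of the monodromy; to the right of the plateau all advances lie strictly
between `0` and `2π`, hence there is no fixed point.

That the monodromy is a Möbius map, and so has at most two fixed points unless it is the identity,
comes from the real-linear equation `u' = -(1 / 2R) Γ' ū` satisfied by a multiple of `e^{iθ/2}`
(`exists_spinor`): its Wronskian is constant, and Cramer's rule expresses every solution through two.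
-/

/-! ### Logarithmic lifts of closed curves -/

/-- A `C¹` curve in `ℂ \ {0}` has a global `C¹` logarithm. -/
theorem exists_log_lift {z z' : ℝ → ℂ} (hz : ∀ t, HasDerivAt z (z' t) t) (hc : Continuous z')
    (h0 : ∀ t, z t ≠ 0) :
    ∃ w : ℝ → ℂ, (∀ t, HasDerivAt w (z' t / z t) t) ∧ ∀ t, Complex.exp (w t) = z t := by
  have hzc : Continuous z := continuous_iff_continuousAt.2 fun t => (hz t).continuousAt
  have hq : Continuous fun t => z' t / z t := hc.div hzc h0
  let w : ℝ → ℂ := fun t => Complex.log (z 0) + ∫ s in (0 : ℝ)..t, z' s / z s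
  have hw : ∀ t, HasDerivAt w (z' t / z t) t := fun t =>
    (intervalIntegral.integral_hasDerivAt_right (hq.intervalIntegrable _ _)
      (hq.stronglyMeasurableAtFilter _ _) hq.continuousAt).const_add _
  -- `z exp (-w)` is constant.
  have hd : ∀ t, HasDerivAt (fun t => z t * Complex.exp (-w t)) 0 t := by
    intro t
    refine ((hz t).mul (hw t).neg.cexp).congr_deriv ?_
    have := h0 t
    simp only [Pi.neg_apply]
    field_simp
    ring
  have hconst : ∀ t, z t * Complex.exp (-w t) = z 0 * Complex.exp (-w 0) := fun t =>
    is_const_of_deriv_eq_zero (fun t => (hd t).differentiableAt) (fun t => (hd t).deriv) t 0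
  refine ⟨w, hw, fun t => ?_⟩
  have h1 := hconst t
  have hw0 : w 0 = Complex.log (z 0) := by simp [w]
  rw [hw0, Complex.exp_neg, Complex.exp_neg, Complex.exp_log (h0 0), mul_inv_cancel₀ (h0 0)] at h1
  field_simp at h1
  exact h1.symm

theorem cexp_eq_iff_re_im {v w : ℂ} :
    Complex.exp v = Complex.exp w ↔ v.re = w.re ∧ ∃ n : ℤ, v.im = w.im + 2 * Real.pi * n := by
  rw [Complex.exp_eq_exp_iff_exists_int]
  constructor
  · rintro ⟨n, rfl⟩
    refine ⟨by simp, n, by simp; ring⟩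
  · rintro ⟨h, n, h'⟩
    refine ⟨n, Complex.ext (by simp [h]) ?_⟩
    simp [h']; ring

/-- The number of turns which a continuous angle makes per period does not depend on the starting
point, being a continuous integer-valued function of it. -/
theorem exists_int_add_period {f : ℝ → ℝ} (hf : Continuous f) {L : ℝ}
    (h : ∀ t, ∃ n : ℤ, f (t + L) = f t + 2 * Real.pi * n) :
    ∃ n : ℤ, ∀ t, f (t + L) = f t + 2 * Real.pi * n := by
  choose n hn using h
  have hc : Continuous fun t => (n t : ℝ) := by
    have : (fun t => (n t : ℝ)) = fun t => (f (t + L) - f t) / (2 * Real.pi) := by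
      funext t
      rw [hn t]
      field_simp
      ring
    rw [this]
    fun_prop
  have hc' : Continuous n := Int.isClosedEmbedding_coe_real.isEmbedding.continuous_iff.2 hc
  refine ⟨n 0, fun t => ?_⟩
  rw [hn t, PreconnectedSpace.constant (inferInstance : PreconnectedSpace ℝ) hc' (x := t) (y := 0)]

/-- A continuous lift of a degree `n` loop on the circle which is injective modulo `2π` on one
period is strictly monotone, and `n = ±1`. -/
theorem degree_of_injective {f : ℝ → ℝ} (hf : Continuous f) {L : ℝ} (hL : 0 < L) {n : ℤ}
    (hn : ∀ t, f (t + L) = f t + 2 * Real.pi * n)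
    (hinj : ∀ s ∈ Set.Ico 0 L, ∀ t ∈ Set.Ico 0 L, ∀ m : ℤ, f s = f t + 2 * Real.pi * m → s = t) :
    (n = 1 ∧ StrictMono f) ∨ (n = -1 ∧ StrictAnti f) := by
  have hpi := Real.pi_pos
  have hL0 : f L = f 0 + 2 * Real.pi * n := by simpa using hn 0
  have hn0 : n ≠ 0 := by
    rintro rfl
    have hL0' : f L = f 0 := by simpa using hL0
    -- The value midway between `f 0` and `f (L / 2)` is taken on both halves of the period.
    have hmid : (f 0 + f (L / 2)) / 2 ∈ Set.uIcc (f 0) (f (L / 2)) := by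
      rcases le_total (f 0) (f (L / 2)) with h | h
      · rw [Set.uIcc_of_le h]; constructor <;> linarith
      · rw [Set.uIcc_of_ge h]; constructor <;> linarith
    obtain ⟨s, hs, hsv⟩ := intermediate_value_uIcc (a := 0) (b := L / 2) hf.continuousOn hmid
    obtain ⟨t, ht, htv⟩ := intermediate_value_uIcc (a := L) (b := L / 2) hf.continuousOn
      (by rw [hL0']; exact hmid)
    rw [Set.uIcc_of_le (by linarith)] at hs
    rw [Set.uIcc_of_ge (by linarith)] at ht
    have hne : f 0 ≠ f (L / 2) := fun h => by
      have := hinj 0 ⟨le_rfl, hL⟩ (L / 2) ⟨by linarith, by linarith⟩ 0 (by simpa using h)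
      linarith
    have htL : t ≠ L := by
      rintro rfl
      exact hne (by linarith)
    have hst := hinj s ⟨hs.1, by linarith [hs.2]⟩ t ⟨by linarith [ht.1], lt_of_le_of_ne ht.2 htL⟩ 0
      (by simp [hsv, htv])
    have : s = L / 2 := le_antisymm hs.2 (hst ▸ ht.1)
    subst this
    exact hne (by linarith)
  have hper : ∀ (k : ℤ) t, f (t + k * L) = f t + 2 * Real.pi * (n * k : ℤ) := by
    intro k
    induction k using Int.induction_on with
    | zero => simp
    | succ i ih =>
      intro t
      have e : t + ((i : ℤ) + 1 : ℤ) * L = (t + (i : ℤ) * L) + L := by push_cast; ring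
      rw [e, hn, ih]; push_cast; ring
    | pred i ih =>
      intro t
      have e : (t + (-(i : ℤ) - 1 : ℤ) * L) + L = t + (-(i : ℤ) : ℤ) * L := by push_cast; ring
      have h1 := hn (t + (-(i : ℤ) - 1 : ℤ) * L)
      rw [e, ih] at h1
      push_cast at h1 ⊢
      linarith
  have hinj' : Function.Injective f := by
    have key : ∀ t, ∃ t₀ ∈ Set.Ico 0 L, ∃ k : ℤ, t = t₀ + k * L := by
      intro t
      refine ⟨toIcoMod hL 0 t, toIcoMod_mem_Ico' hL t, toIcoDiv hL 0 t, ?_⟩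
      simp
    intro s t hst
    obtain ⟨s₀, hs, k, rfl⟩ := key s
    obtain ⟨t₀, ht, l, rfl⟩ := key t
    rw [hper, hper] at hst
    have h1 : s₀ = t₀ := hinj s₀ hs t₀ ht (n * l - n * k) (by push_cast at hst ⊢; linarith)
    subst h1
    have h2 : ((n * k : ℤ) : ℝ) = (n * l : ℤ) := by
      have : 2 * Real.pi * ((n * k : ℤ) : ℝ) = 2 * Real.pi * (n * l : ℤ) := by linarith
      exact mul_left_cancel₀ (by positivity) this
    rw [mul_left_cancel₀ hn0 (Int.cast_injective h2)]
  -- A full turn is completed only at the end of the period.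
  have hfull : ∀ t ∈ Set.Icc 0 L, ∀ m : ℤ, m ≠ 0 → f t = f 0 + 2 * Real.pi * m → t = L := by
    intro t ht m hm h
    by_contra hne
    have h0 := hinj t ⟨ht.1, lt_of_le_of_ne ht.2 hne⟩ 0 ⟨le_rfl, hL⟩ m h
    subst h0
    have : 2 * Real.pi * (m : ℝ) = 0 := by linarith
    have : (m : ℝ) = 0 := by
      rcases mul_eq_zero.1 this with h | h
      · linarith
      · exact h
    exact hm (by exact_mod_cast this)
  rcases hf.strictMono_of_inj hinj' with hm | hm
  · refine Or.inl ⟨?_, hm⟩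
    have h1 : 0 < 2 * Real.pi * (n : ℝ) := by linarith [hm hL]
    have hnpos : (0 : ℝ) < n := pos_of_mul_pos_right h1 (by positivity)
    have hn1 : (1 : ℤ) ≤ n := by have : (0 : ℤ) < n := by exact_mod_cast hnpos
                                 omega
    have hn1' : (1 : ℝ) ≤ n := by exact_mod_cast hn1
    obtain ⟨t, ht, htv⟩ := intermediate_value_Icc hL.le hf.continuousOn
      (show f 0 + 2 * Real.pi * (1 : ℤ) ∈ Set.Icc (f 0) (f L) by
        rw [hL0]; push_cast; constructor <;> nlinarith)
    have := hfull t ht 1 one_ne_zero htv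
    subst this
    have h2 : 2 * Real.pi * (n : ℝ) = 2 * Real.pi * (1 : ℤ) := by linarith
    exact Int.cast_injective (mul_left_cancel₀ (by positivity) h2)
  · refine Or.inr ⟨?_, hm⟩
    have h1 : 0 < 2 * Real.pi * (-n : ℝ) := by linarith [hm hL]
    have hnpos : (0 : ℝ) < -n := pos_of_mul_pos_right h1 (by positivity)
    have hn1 : n ≤ -1 := by have : n < 0 := by exact_mod_cast (by linarith : (n : ℝ) < 0)
                            omega
    have hn1' : (n : ℝ) ≤ -1 := by exact_mod_cast hn1
    obtain ⟨t, ht, htv⟩ := intermediate_value_Icc' hL.le hf.continuousOn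
      (show f 0 + 2 * Real.pi * (-1 : ℤ) ∈ Set.Icc (f L) (f 0) by
        rw [hL0]; push_cast; constructor <;> nlinarith)
    have := hfull t ht (-1) (by norm_num) htv
    subst this
    have h2 : 2 * Real.pi * (n : ℝ) = 2 * Real.pi * (-1 : ℤ) := by linarith
    exact Int.cast_injective (mul_left_cancel₀ (by positivity) h2)

namespace RegularClosedCurve

/-! ### Polar coordinates of a star-shaped curve -/

/-- Polar coordinates `Γ = z₀ + r e^{iφ}` of a closed curve about a centre `z₀`, with `C¹` radius
and angle, where the angle is monotone in the direction `sgn = ±1` and makes one turn. The centre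
enters only through `Γ' = (r' + i r φ') e^{iφ}`. -/
structure PolarCoords (Γ : RegularClosedCurve) where
  r : ℝ → ℝ
  φ : ℝ → ℝ
  r' : ℝ → ℝ
  φ' : ℝ → ℝ
  sgn : ℤ
  sgn_eq : sgn = 1 ∨ sgn = -1
  r_pos : ∀ t, 0 < r t
  hasDerivAt_r : ∀ t, HasDerivAt r (r' t) t
  hasDerivAt_φ : ∀ t, HasDerivAt φ (φ' t) t
  continuous_φ' : Continuous φ'
  deriv_eq : ∀ t, deriv Γ.toFun t = (r' t + r t * φ' t * Complex.I) * Complex.exp (φ t * Complex.I)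
  sgn_mul_φ'_nonneg : ∀ t, 0 ≤ sgn * φ' t
  r_add_period : ∀ t, r (t + Γ.period) = r t
  φ_add_period : ∀ t, φ (t + Γ.period) = φ t + 2 * Real.pi * sgn

theorem hasDerivAt (Γ : RegularClosedCurve) (t : ℝ) :
    HasDerivAt Γ.toFun (deriv Γ.toFun t) t :=
  (Γ.contDiff.differentiable (by norm_num) t).hasDerivAt

/-- The centre of a star-shaped curve does not lie on the curve: it would lie on every ray. -/
theorem centre_notMem (Γ : RegularClosedCurve) {z₀ : ℂ}
    (h : ∀ u : Circle, ∃! t : ℝ, t ∈ Set.Ico 0 Γ.period ∧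
      ∃ s : ℝ, 0 ≤ s ∧ Γ.toFun t = z₀ + (s : ℂ) * (u : ℂ)) (t : ℝ) : Γ.toFun t - z₀ ≠ 0 := by
  intro ht
  obtain ⟨t₀, ht₀, e⟩ := Γ.periodic.exists_mem_Ico₀ Γ.period_pos t
  have ht₁ : Γ.toFun t₀ = z₀ := by rw [← e]; exact sub_eq_zero.1 ht
  obtain ⟨t₁, ht₁', hne⟩ : ∃ t₁ ∈ Set.Ico 0 Γ.period, t₁ ≠ t₀ := by
    have hL := Γ.period_pos
    by_cases h0 : t₀ = 0
    · exact ⟨Γ.period / 2, ⟨by linarith, by linarith⟩, by rw [h0]; positivity⟩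
    · exact ⟨0, ⟨le_rfl, hL⟩, fun h => h0 h.symm⟩
  let u : Circle := Circle.exp (Complex.arg (Γ.toFun t₁ - z₀))
  refine hne ((h u).unique ⟨ht₁', ‖Γ.toFun t₁ - z₀‖, norm_nonneg _, ?_⟩
    ⟨ht₀, 0, le_rfl, by simp [ht₁]⟩)
  rw [Circle.coe_exp, Complex.norm_mul_exp_arg_mul_I]
  ring

theorem IsStarShaped.exists_polarCoords {Γ : RegularClosedCurve} (hΓ : Γ.IsStarShaped) :
    Nonempty Γ.PolarCoords := by
  obtain ⟨z₀, h⟩ := hΓ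
  have h0 := Γ.centre_notMem h
  obtain ⟨w, hw, hexp⟩ := exists_log_lift (fun t => (Γ.hasDerivAt t).sub_const z₀)
    Γ.contDiff_deriv.continuous h0
  have hwc : Continuous w := continuous_iff_continuousAt.2 fun t => (hw t).continuousAt
  have hq : Continuous fun t => deriv Γ.toFun t / (Γ.toFun t - z₀) :=
    Γ.contDiff_deriv.continuous.div (Γ.contDiff.continuous.sub continuous_const) h0
  have him : ∀ t, HasDerivAt (fun t => (w t).im) (deriv Γ.toFun t / (Γ.toFun t - z₀)).im t :=
    fun t => Complex.imCLM.hasFDerivAt.comp_hasDerivAt t (hw t)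
  have hre : ∀ t, HasDerivAt (fun t => (w t).re) (deriv Γ.toFun t / (Γ.toFun t - z₀)).re t :=
    fun t => Complex.reCLM.hasFDerivAt.comp_hasDerivAt t (hw t)
  have hwp : ∀ t, (w (t + Γ.period)).re = (w t).re ∧
      ∃ n : ℤ, (w (t + Γ.period)).im = (w t).im + 2 * Real.pi * n := fun t =>
    cexp_eq_iff_re_im.1 (by rw [hexp, hexp, Γ.periodic t])
  obtain ⟨n, hn⟩ := exists_int_add_period (Complex.continuous_im.comp hwc) fun t => (hwp t).2
  simp only [Function.comp_apply] at hn
  have hpolar : ∀ t, Γ.toFun t = z₀ + (Real.exp (w t).re : ℝ) * Circle.exp (w t).im := by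
    intro t
    rw [Circle.coe_exp, Complex.ofReal_exp, ← Complex.exp_add, Complex.re_add_im, hexp]
    ring
  have hinj : ∀ s ∈ Set.Ico 0 Γ.period, ∀ t ∈ Set.Ico 0 Γ.period, ∀ m : ℤ,
      (w s).im = (w t).im + 2 * Real.pi * m → s = t := by
    intro s hs t ht m hm
    refine (h (Circle.exp (w t).im)).unique ⟨hs, _, (Real.exp_pos (w s).re).le, ?_⟩
      ⟨ht, _, (Real.exp_pos (w t).re).le, hpolar t⟩
    rw [hpolar s, Circle.exp_eq_exp.2 ⟨m, by rw [hm]; ring⟩]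
  have hdeg := degree_of_injective (Complex.continuous_im.comp hwc) Γ.period_pos hn hinj
  refine ⟨{
    r := fun t => Real.exp (w t).re
    φ := fun t => (w t).im
    r' := fun t => Real.exp (w t).re * (deriv Γ.toFun t / (Γ.toFun t - z₀)).re
    φ' := fun t => (deriv Γ.toFun t / (Γ.toFun t - z₀)).im
    sgn := n
    sgn_eq := hdeg.imp And.left And.left
    r_pos := fun t => Real.exp_pos _
    hasDerivAt_r := fun t => (hre t).exp
    hasDerivAt_φ := him
    continuous_φ' := Complex.continuous_im.comp hq
    deriv_eq := fun t => ?_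
    sgn_mul_φ'_nonneg := fun t => ?_
    r_add_period := fun t => by simp only [(hwp t).1]
    φ_add_period := hn }⟩
  · have e1 : deriv Γ.toFun t = deriv Γ.toFun t / (Γ.toFun t - z₀) * Complex.exp (w t) := by
      rw [hexp, div_mul_cancel₀ _ (h0 t)]
    have e2 : Complex.exp (w t)
        = (Real.exp (w t).re : ℝ) * Complex.exp ((w t).im * Complex.I) := by
      rw [Complex.ofReal_exp, ← Complex.exp_add, Complex.re_add_im]
    conv_lhs => rw [e1, e2, ← Complex.re_add_im (deriv Γ.toFun t / (Γ.toFun t - z₀))]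
    push_cast
    ring
  · rcases hdeg with ⟨rfl, hm⟩ | ⟨rfl, hm⟩
    · have := hm.monotone.deriv_nonneg (x := t)
      rw [show deriv (Complex.im ∘ w) t = _ from (him t).deriv] at this
      simpa using this
    · have := hm.antitone.deriv_nonpos (x := t)
      rw [show deriv (Complex.im ∘ w) t = _ from (him t).deriv] at this
      simpa using this

end RegularClosedCurve

/-! ### Hyperbolic translations acting on angles -/

/-- The action on angles of the hyperbolic translation by `-k` along the direction `0`: the lift to
`ℝ`, fixing the multiples of `π`, of the circle map `α ↦ β` with `tan (β / 2) = e^{-k} tan (α / 2)`.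
It is the time `-k` map of the flow of `α' = sin α`. The formula with `arctan` of the half difference
has a positive denominator, so that no case distinction is needed. -/
noncomputable def boost (k α : ℝ) : ℝ :=
  α - 2 * Real.arctan (Real.sinh k * Real.sin α / (1 + Real.cosh k + Real.sinh k * Real.cos α))

theorem cosh_add_sinh_mul_pos (k : ℝ) {c : ℝ} (h₁ : -1 ≤ c) (h₂ : c ≤ 1) :
    0 < Real.cosh k + Real.sinh k * c := by
  have hs : |Real.sinh k| < Real.cosh k :=
    abs_lt_of_sq_lt_sq (by linarith [Real.cosh_sq k]) (Real.cosh_pos k).le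
  have : |Real.sinh k * c| ≤ |Real.sinh k| := by
    rw [abs_mul]
    exact mul_le_of_le_one_right (abs_nonneg _) (abs_le.2 ⟨h₁, h₂⟩)
  linarith [neg_abs_le (Real.sinh k * c)]

theorem cosh_add_sinh_mul_cos_pos (k α : ℝ) : 0 < Real.cosh k + Real.sinh k * Real.cos α :=
  cosh_add_sinh_mul_pos k (Real.neg_one_le_cos α) (Real.cos_le_one α)

theorem boost_add_two_pi_mul (k α : ℝ) (n : ℤ) :
    boost k (α + 2 * Real.pi * n) = boost k α + 2 * Real.pi * n := by
  have e : α + 2 * Real.pi * n = α + n * (2 * Real.pi) := by ring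
  simp only [boost, e, Real.sin_add_int_mul_two_pi, Real.cos_add_int_mul_two_pi]
  ring

theorem HasDerivAt.boost {k α : ℝ → ℝ} {k' α' t : ℝ} (hk : HasDerivAt k k' t)
    (hα : HasDerivAt α α' t) :
    HasDerivAt (fun t => boost (k t) (α t))
      ((α' - k' * Real.sin (α t)) / (Real.cosh (k t) + Real.sinh (k t) * Real.cos (α t))) t := by
  have hp := cosh_add_sinh_mul_cos_pos (k t) (α t)
  have hp1 : 1 + Real.cosh (k t) + Real.sinh (k t) * Real.cos (α t) ≠ 0 := by linarith
  have hq := (hk.sinh.mul hα.sin).div ((hk.cosh.const_add 1).add (hk.sinh.mul hα.cos)) hp1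
  refine (hα.sub (hq.arctan.const_mul 2)).congr_deriv ?_
  have hC := Real.cosh_sq (k t)
  have hc := Real.sin_sq_add_cos_sq (α t)
  simp only [Pi.mul_apply, Pi.add_apply, Pi.div_apply]
  generalize Real.cosh (k t) = C at *
  generalize Real.sinh (k t) = S at *
  generalize Real.sin (α t) = s at *
  generalize Real.cos (α t) = c at *
  have hne := hp.ne'
  have hC1 : 0 < 1 + C + S * c := by linarith
  have h2 : (1 + C + S * c) ^ 2 + (S * s) ^ 2 = 2 * (1 + C) * (C + S * c) := by
    linear_combination (-1 : ℝ) * hC + S ^ 2 * hc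
  have hC0 : (0 : ℝ) < 1 + C := by
    by_contra h
    have : (1 + C + S * c) ^ 2 + (S * s) ^ 2 ≤ 0 := by
      rw [h2]; exact mul_nonpos_of_nonpos_of_nonneg (by linarith) hp.le
    nlinarith [sq_nonneg (S * s), pow_pos hC1 2]
  have h3 : 1 + (S * s / (1 + C + S * c)) ^ 2 = 2 * (1 + C) * (C + S * c) / (1 + C + S * c) ^ 2 := by
    rw [← h2]; field_simp
  rw [h3]
  field_simp
  linear_combination (α' - k' * s) * hC - α' * S ^ 2 * hc

theorem cos_boost (k α : ℝ) :
    Real.cos (boost k α) = (Real.cosh k * Real.cos α + Real.sinh k)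
      / (Real.cosh k + Real.sinh k * Real.cos α) := by
  have hp := cosh_add_sinh_mul_cos_pos k α
  have hp1 : 0 < 1 + Real.cosh k + Real.sinh k * Real.cos α := by linarith
  have hC := Real.cosh_sq k
  have hc := Real.sin_sq_add_cos_sq α
  have hC0 : (0 : ℝ) < 1 + Real.cosh k := by linarith [Real.cosh_pos k]
  set q := Real.sinh k * Real.sin α / (1 + Real.cosh k + Real.sinh k * Real.cos α) with hq
  have h2 : 1 + q ^ 2 = 2 * (1 + Real.cosh k) * (Real.cosh k + Real.sinh k * Real.cos α)
      / (1 + Real.cosh k + Real.sinh k * Real.cos α) ^ 2 := by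
    rw [hq]
    field_simp
    linear_combination (-1 : ℝ) * hC + Real.sinh k ^ 2 * hc
  have hcos : Real.cos (2 * Real.arctan q) = 2 / (1 + q ^ 2) - 1 := by
    rw [Real.cos_two_mul, Real.cos_sq_arctan]; ring
  have hsin : Real.sin (2 * Real.arctan q) = 2 * q / (1 + q ^ 2) := by
    have h := Real.cos_sq_arctan q
    have h' : Real.sin (Real.arctan q) = q * Real.cos (Real.arctan q) := by
      rw [← Real.tan_mul_cos (Real.cos_arctan_pos q).ne', Real.tan_arctan]
    rw [Real.sin_two_mul, h']
    linear_combination 2 * q * h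
  have e : boost k α = α - 2 * Real.arctan q := rfl
  rw [e, Real.cos_sub, hcos, hsin, h2, hq]
  generalize Real.cosh k = C at *
  generalize Real.sinh k = S at *
  generalize Real.sin α = s at *
  generalize Real.cos α = c at *
  have hne : C + c * S ≠ 0 := by linarith
  field_simp
  linear_combination ((1 + C) * S + c * S ^ 2) * hc - c * hC

theorem hasDerivAt_boost (k α : ℝ) :
    HasDerivAt (boost k) (1 / (Real.cosh k + Real.sinh k * Real.cos α)) α := by
  simpa using (hasDerivAt_const α k).boost (hasDerivAt_id α)

theorem continuous_boost (k : ℝ) : Continuous (boost k) :=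
  continuous_iff_continuousAt.2 fun α => (hasDerivAt_boost k α).continuousAt

theorem monotone_boost (k : ℝ) : Monotone (boost k) :=
  monotone_of_deriv_nonneg (fun α => (hasDerivAt_boost k α).differentiableAt) fun α => by
    rw [(hasDerivAt_boost k α).deriv]
    exact one_div_nonneg.2 (cosh_add_sinh_mul_cos_pos k α).le

theorem surjective_boost (k : ℝ) : Function.Surjective (boost k) := by
  refine (continuous_boost k).surjective ?_ ?_
  · refine Filter.tendsto_atTop_mono (fun α => ?_) (Filter.tendsto_atTop_add_const_right _ (-Real.pi)
      Filter.tendsto_id)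
    have := Real.arctan_lt_pi_div_two
      (Real.sinh k * Real.sin α / (1 + Real.cosh k + Real.sinh k * Real.cos α))
    simp only [boost, id]
    linarith
  · refine Filter.tendsto_atBot_mono (fun α => ?_) (Filter.tendsto_atBot_add_const_right _ Real.pi
      Filter.tendsto_id)
    have := Real.neg_pi_div_two_lt_arctan
      (Real.sinh k * Real.sin α / (1 + Real.cosh k + Real.sinh k * Real.cos α))
    simp only [boost, id]
    linarith

/-! ### Monotonicity of the transformed equation -/

/-- The angular speed, per unit of polar angle, of the bicycle equation in the moving frame obtained
by translating the point at scaled distance `k` back to the centre; `c` is the cosine of the angle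
with the radial direction. -/
noncomputable def centredSpeed (k c : ℝ) : ℝ :=
  1 - Real.cosh k + k * Real.sinh k + c * (Real.sinh k - k * Real.cosh k)

theorem hasDerivAt_centredSpeed (k c : ℝ) :
    HasDerivAt (fun k => centredSpeed k c) (k * (Real.cosh k + Real.sinh k * (-c))) k := by
  have h := (((hasDerivAt_const k (1 : ℝ)).sub (Real.hasDerivAt_cosh k)).add
    ((hasDerivAt_id k).mul (Real.hasDerivAt_sinh k))).add
    (((Real.hasDerivAt_sinh k).sub ((hasDerivAt_id k).mul (Real.hasDerivAt_cosh k))).const_mul c)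
  refine h.congr_deriv ?_
  simp only [id]
  ring

theorem centredSpeed_strictMonoOn {c : ℝ} (h₁ : -1 ≤ c) (h₂ : c ≤ 1) :
    StrictMonoOn (fun k => centredSpeed k c) (Set.Ici 0) := by
  refine strictMonoOn_of_deriv_pos (convex_Ici 0)
    (fun k _ => (hasDerivAt_centredSpeed k c).continuousAt.continuousWithinAt) fun k hk => ?_
  rw [interior_Ici] at hk
  rw [(hasDerivAt_centredSpeed k c).deriv]
  exact mul_pos hk (cosh_add_sinh_mul_pos k (by linarith) (by linarith))

/-- A solution of `D' = m D + f` with `D 0 = 0` and `f ≥ 0`, `f` not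
identically zero on `(0, L)`, is positive at `L`. -/
theorem pos_of_linear_ode {D m f : ℝ → ℝ} {L : ℝ} (hm : Continuous m)
    (hD : ∀ t, HasDerivAt D (m t * D t + f t) t) (hf : ∀ t, 0 ≤ f t) (h0 : D 0 = 0)
    (hpos : ∃ c ∈ Set.Ioo 0 L, 0 < f c) : 0 < D L := by
  let E : ℝ → ℝ := fun t => D t * Real.exp (-∫ s in (0 : ℝ)..t, m s)
  have hE : ∀ t, HasDerivAt E (f t * Real.exp (-∫ s in (0 : ℝ)..t, m s)) t := by
    intro t
    have hM : HasDerivAt (fun t => ∫ s in (0 : ℝ)..t, m s) (m t) t :=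
      intervalIntegral.integral_hasDerivAt_right (hm.intervalIntegrable _ _)
        (hm.stronglyMeasurableAtFilter _ _) hm.continuousAt
    refine ((hD t).mul hM.neg.exp).congr_deriv ?_
    simp only [Pi.neg_apply]
    ring
  have hmono : Monotone E := monotone_of_deriv_nonneg (fun t => (hE t).differentiableAt) fun t => by
    rw [(hE t).deriv]
    exact mul_nonneg (hf t) (Real.exp_pos _).le
  have hE0 : E 0 = 0 := by simp [E, h0]
  obtain ⟨c, hc, hfc⟩ := hpos
  have hEL : 0 < E L := by
    by_contra h
    -- Otherwise `E` vanishes on `[0, L]`, and so does its derivative at `c`.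
    have hev : E =ᶠ[nhds c] fun _ => 0 := by
      filter_upwards [Ioo_mem_nhds hc.1 hc.2] with t ht
      exact le_antisymm ((hmono ht.2.le).trans (not_lt.1 h)) (hE0 ▸ hmono ht.1.le)
    have h1 := hev.deriv_eq
    rw [(hE c).deriv, deriv_const] at h1
    exact (mul_pos hfc (Real.exp_pos _)).ne' h1
  exact pos_of_mul_pos_left hEL (Real.exp_pos _).le

namespace RegularClosedCurve

namespace PolarCoords

variable {Γ : RegularClosedCurve}

/-- The bicycle angle `θ` at time `t` seen from the centre: the angle obtained from `θ` by the
hyperbolic translation which carries the point at scaled distance `r / R` in the direction `φ` back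
to the centre. -/
noncomputable def centred (P : Γ.PolarCoords) (R t θ : ℝ) : ℝ :=
  P.φ t + boost (P.r t / R) (θ - P.φ t)

theorem centred_period (P : Γ.PolarCoords) (R θ : ℝ) :
    P.centred R Γ.period θ = P.centred R 0 θ := by
  have hr := P.r_add_period 0
  have hφ := P.φ_add_period 0
  rw [zero_add] at hr hφ
  have e : θ - (P.φ 0 + 2 * Real.pi * P.sgn)
      = θ - P.φ 0 + 2 * Real.pi * ((-P.sgn : ℤ) : ℝ) := by push_cast; ring
  rw [centred, centred, hr, hφ, e, boost_add_two_pi_mul]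
  push_cast
  ring

theorem centred_add_two_pi_mul (P : Γ.PolarCoords) (R t θ : ℝ) (n : ℤ) :
    P.centred R t (θ + 2 * Real.pi * n) = P.centred R t θ + 2 * Real.pi * n := by
  have e : θ + 2 * Real.pi * n - P.φ t = θ - P.φ t + 2 * Real.pi * n := by ring
  rw [centred, centred, e, boost_add_two_pi_mul]
  ring

theorem monotone_centred (P : Γ.PolarCoords) (R t : ℝ) : Monotone (P.centred R t) := fun a b hab =>
  add_le_add le_rfl (monotone_boost _ (by linarith))

theorem surjective_centred (P : Γ.PolarCoords) (R t : ℝ) :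
    Function.Surjective (P.centred R t) := by
  intro y
  obtain ⟨x, hx⟩ := surjective_boost (P.r t / R) (y - P.φ t)
  exact ⟨x + P.φ t, by rw [centred, add_sub_cancel_right, hx]; ring⟩

theorem field_eq (P : Γ.PolarCoords) (R t θ : ℝ) :
    Γ.field R t θ = P.r' t / R * Real.sin (θ - P.φ t)
      - P.r t / R * P.φ' t * Real.cos (θ - P.φ t) := by
  have hre : (deriv Γ.toFun t).re
      = P.r' t * Real.cos (P.φ t) - P.r t * P.φ' t * Real.sin (P.φ t) := by
    rw [P.deriv_eq]
    simp [Complex.exp_re, Complex.exp_im]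
  have him : (deriv Γ.toFun t).im
      = P.r' t * Real.sin (P.φ t) + P.r t * P.φ' t * Real.cos (P.φ t) := by
    rw [P.deriv_eq]
    simp [Complex.exp_re, Complex.exp_im]
  rw [field, hre, him, Real.sin_sub, Real.cos_sub]
  ring

/-- In the centred angle the radial velocity drops out of the bicycle equation. -/
theorem hasDerivAt_centred (P : Γ.PolarCoords) {R : ℝ} {θ : ℝ → ℝ}
    (hθ : IsIntegralCurve θ (Γ.field R)) (t : ℝ) :
    HasDerivAt (fun t => P.centred R t (θ t))
      (P.φ' t * centredSpeed (P.r t / R) (Real.cos (P.centred R t (θ t) - P.φ t))) t := by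
  have h := (P.hasDerivAt_φ t).add
    (((P.hasDerivAt_r t).div_const R).boost ((hθ t).sub (P.hasDerivAt_φ t)))
  refine h.congr_deriv ?_
  have e : P.centred R t (θ t) - P.φ t = boost (P.r t / R) (θ t - P.φ t) := by
    rw [centred]; ring
  have hp := cosh_add_sinh_mul_cos_pos (P.r t / R) (θ t - P.φ t)
  rw [e, cos_boost, centredSpeed, P.field_eq]
  have hC := Real.cosh_sq (P.r t / R)
  have e1 : P.r' t / R = P.r' t * (1 / R) := by ring
  simp only [Pi.sub_apply]
  generalize Real.cosh (P.r t / R) = C at *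
  generalize Real.sinh (P.r t / R) = S at *
  generalize Real.cos (θ t - P.φ t) = c at *
  generalize Real.sin (θ t - P.φ t) = s at *
  generalize P.r t / R = k at *
  generalize P.r' t / R = k' at *
  have hne : C + c * S ≠ 0 := by linarith
  field_simp
  linear_combination (P.φ' t * (1 + k * c)) * hC

/-- Shrinking `R` strictly advances, in the direction of `sgn`, the centred angle after one period.
The value `R₁ = 0`, for which the field vanishes because `1 / 0 = 0`, stands for `R₁ = ∞`. -/
theorem centred_lt_centred (P : Γ.PolarCoords) {R₁ R₂ : ℝ} (h₁ : 0 ≤ 1 / R₁)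
    (h₁₂ : 1 / R₁ < 1 / R₂) {θ₁ θ₂ : ℝ → ℝ} (hθ₁ : IsIntegralCurve θ₁ (Γ.field R₁))
    (hθ₂ : IsIntegralCurve θ₂ (Γ.field R₂))
    (h0 : P.centred R₁ 0 (θ₁ 0) = P.centred R₂ 0 (θ₂ 0)) :
    0 < P.sgn * (P.centred R₂ Γ.period (θ₂ Γ.period) - P.centred R₁ Γ.period (θ₁ Γ.period)) := by
  let y₁ : ℝ → ℝ := fun t => P.centred R₁ t (θ₁ t)
  let y₂ : ℝ → ℝ := fun t => P.centred R₂ t (θ₂ t)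
  have hy₁ := P.hasDerivAt_centred hθ₁
  have hy₂ := P.hasDerivAt_centred hθ₂
  have cy₁ : Continuous y₁ := continuous_iff_continuousAt.2 fun t => (hy₁ t).continuousAt
  have cy₂ : Continuous y₂ := continuous_iff_continuousAt.2 fun t => (hy₂ t).continuousAt
  have cφ : Continuous P.φ := continuous_iff_continuousAt.2 fun t => (P.hasDerivAt_φ t).continuousAt
  have cφ' := P.continuous_φ'
  have cr : Continuous P.r := continuous_iff_continuousAt.2 fun t => (P.hasDerivAt_r t).continuousAt
  have hk : ∀ t, centredSpeed (P.r t / R₁) (Real.cos (y₂ t - P.φ t))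
      < centredSpeed (P.r t / R₂) (Real.cos (y₂ t - P.φ t)) := by
    intro t
    have hr := P.r_pos t
    have e₁ : P.r t / R₁ = P.r t * (1 / R₁) := by ring
    have e₂ : P.r t / R₂ = P.r t * (1 / R₂) := by ring
    refine centredSpeed_strictMonoOn (Real.neg_one_le_cos _) (Real.cos_le_one _) ?_ ?_ ?_
    · rw [e₁]; exact mul_nonneg hr.le h₁
    · rw [e₂]; exact mul_nonneg hr.le (h₁.trans h₁₂.le)
    · rw [e₁, e₂]; exact mul_lt_mul_of_pos_left h₁₂ hr
  -- The difference quotient of the cosine, written with `sinc` so that it is continuous.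
  let m : ℝ → ℝ := fun t => P.φ' t * (Real.sinh (P.r t / R₁) - P.r t / R₁ * Real.cosh (P.r t / R₁))
    * (-(Real.sin ((y₂ t - P.φ t + (y₁ t - P.φ t)) / 2) * Real.sinc ((y₂ t - y₁ t) / 2)))
  have hm : Continuous m := by
    have := Real.continuous_sinc
    fun_prop
  refine lt_of_lt_of_eq (pos_of_linear_ode (D := fun t => P.sgn * (y₂ t - y₁ t)) (L := Γ.period)
    (f := fun t => P.sgn * P.φ' t * (centredSpeed (P.r t / R₂) (Real.cos (y₂ t - P.φ t))
      - centredSpeed (P.r t / R₁) (Real.cos (y₂ t - P.φ t)))) hm ?_ ?_ ?_ ?_) rfl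
  · intro t
    refine (((hy₂ t).sub (hy₁ t)).const_mul (P.sgn : ℝ)).congr_deriv ?_
    have hcos : Real.cos (y₂ t - P.φ t) - Real.cos (y₁ t - P.φ t)
        = -(Real.sin ((y₂ t - P.φ t + (y₁ t - P.φ t)) / 2) * Real.sinc ((y₂ t - y₁ t) / 2))
          * (y₂ t - y₁ t) := by
      have e : Real.sin ((y₂ t - y₁ t) / 2) = Real.sinc ((y₂ t - y₁ t) / 2) * ((y₂ t - y₁ t) / 2) := by
        by_cases h : (y₂ t - y₁ t) / 2 = 0
        · simp [h]
        · rw [Real.sinc_of_ne_zero h, div_mul_cancel₀ _ h]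
      rw [Real.cos_sub_cos, show (y₂ t - P.φ t - (y₁ t - P.φ t)) / 2 = (y₂ t - y₁ t) / 2 by ring, e]
      ring
    change (P.sgn : ℝ) * (P.φ' t * centredSpeed (P.r t / R₂) (Real.cos (y₂ t - P.φ t))
      - P.φ' t * centredSpeed (P.r t / R₁) (Real.cos (y₁ t - P.φ t))) = _
    simp only [centredSpeed, m]
    linear_combination (P.sgn * P.φ' t
      * (Real.sinh (P.r t / R₁) - P.r t / R₁ * Real.cosh (P.r t / R₁))) * hcos
  · exact fun t => mul_nonneg (P.sgn_mul_φ'_nonneg t) (sub_nonneg.2 (hk t).le)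
  · simp only [y₁, y₂, h0, sub_self, mul_zero]
  · -- `φ` makes a full turn, so its derivative does not vanish identically.
    obtain ⟨c, hc, hcs⟩ := exists_hasDerivAt_eq_slope P.φ P.φ' Γ.period_pos cφ.continuousOn
      fun t _ => P.hasDerivAt_φ t
    refine ⟨c, hc, mul_pos (lt_of_le_of_ne (P.sgn_mul_φ'_nonneg c) ?_) (sub_pos.2 (hk c))⟩
    have hφ := P.φ_add_period 0
    rw [zero_add] at hφ
    have hs : (P.sgn : ℝ) ≠ 0 := by
      rcases P.sgn_eq with h | h <;> simp [h]
    rw [hcs, hφ, add_sub_cancel_left]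
    have hL := Γ.period_pos
    have hpi := Real.pi_pos
    exact (mul_ne_zero hs (div_ne_zero (mul_ne_zero (by positivity) hs) (by linarith))).symm

end PolarCoords

end RegularClosedCurve

namespace RegularClosedCurve

variable (Γ : RegularClosedCurve)

/-! ### The Poincaré map and its rotation number -/

theorem continuous_angle (R θ₀ : ℝ) : Continuous (Γ.angle R θ₀) :=
  continuous_iff_continuousAt.2 fun t => (Γ.angle_isIntegralCurve R θ₀ t).continuousAt

theorem continuous_poincare (R : ℝ) : Continuous (Γ.poincare R) := by
  obtain ⟨K, hK, -⟩ := Γ.exists_bound R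
  refine (LipschitzWith.of_dist_le_mul (K := ⟨Real.exp (K * Γ.period), (Real.exp_pos _).le⟩)
    fun x y => ?_).continuous
  have h := dist_le_of_trajectories_ODE (v := Γ.field R) (δ := dist x y) hK
    (Γ.continuous_angle R x).continuousOn
    (fun t _ => (Γ.angle_isIntegralCurve R x t).hasDerivWithinAt)
    (Γ.continuous_angle R y).continuousOn
    (fun t _ => (Γ.angle_isIntegralCurve R y t).hasDerivWithinAt)
    (by rw [angle_zero, angle_zero]) Γ.period (Set.right_mem_Icc.2 Γ.period_pos.le)
  rw [sub_zero, mul_comm] at h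
  exact h

theorem poincare_add_two_pi_mul (R θ : ℝ) (k : ℤ) :
    Γ.poincare R (θ + 2 * Real.pi * k) = Γ.poincare R θ + 2 * Real.pi * k := by
  have := Γ.angle_add_two_pi R θ Γ.period k
  rwa [mul_comm (k : ℝ)] at this

theorem rotationNumber_eq_int_iff (R : ℝ) (m : ℤ) :
    Γ.rotationNumber R = m ↔ ∃ θ, Γ.poincare R θ = θ + 2 * Real.pi * m := by
  have h2 := Real.two_pi_pos
  have hf : Continuous (Γ.poincareLift R) :=
    ((Γ.continuous_poincare R).comp (continuous_const.mul continuous_id)).div_const _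
  rw [tendsto_nhds_unique (Γ.tendsto_rotationNumber R 0) (Γ.tendsto_translationNumber R 0),
    (Γ.poincareLift R).translationNumber_eq_int_iff hf]
  have key : ∀ x, Γ.poincareLift R x = Γ.poincare R (2 * Real.pi * x) / (2 * Real.pi) := fun _ => rfl
  constructor
  · rintro ⟨x, hx⟩
    rw [key, div_eq_iff h2.ne'] at hx
    exact ⟨2 * Real.pi * x, by rw [hx]; ring⟩
  · rintro ⟨θ, hθ⟩
    refine ⟨θ / (2 * Real.pi), ?_⟩
    rw [key, mul_div_cancel₀ _ h2.ne', hθ]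
    field_simp

/-! ### The tangent angle and the rotation index -/

/-- A continuous argument `ψ` of the velocity; its increment over a period is `2π ω(Γ)`. -/
theorem exists_tangentAngle :
    ∃ ψ ψ' : ℝ → ℝ, (∀ t, HasDerivAt ψ (ψ' t) t) ∧ Continuous ψ' ∧
      (∀ t, deriv Γ.toFun t = ‖deriv Γ.toFun t‖ * Complex.exp (ψ t * Complex.I)) ∧
      ψ Γ.period = ψ 0 + 2 * Real.pi * Γ.rotationIndex ∧
      ∃ n : ℤ, ψ Γ.period = ψ 0 + 2 * Real.pi * n := by
  have hd : ∀ t, HasDerivAt (deriv Γ.toFun) (deriv (deriv Γ.toFun) t) t := fun t =>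
    (Γ.contDiff_deriv.differentiable (by norm_num) t).hasDerivAt
  have hc : Continuous (deriv (deriv Γ.toFun)) := Γ.contDiff_deriv.continuous_deriv le_rfl
  obtain ⟨w, hw, hexp⟩ := exists_log_lift hd hc Γ.regular
  have hq : Continuous fun t => deriv (deriv Γ.toFun) t / deriv Γ.toFun t :=
    hc.div Γ.contDiff_deriv.continuous Γ.regular
  have him : ∀ t, HasDerivAt (fun t => (w t).im)
      (deriv (deriv Γ.toFun) t / deriv Γ.toFun t).im t :=
    fun t => Complex.imCLM.hasFDerivAt.comp_hasDerivAt t (hw t)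
  have hqc := Complex.continuous_im.comp hq
  refine ⟨fun t => (w t).im, fun t => (deriv (deriv Γ.toFun) t / deriv Γ.toFun t).im, him, hqc,
    fun t => ?_, ?_, ?_⟩
  · rw [← hexp t, Complex.norm_exp, Complex.ofReal_exp, ← Complex.exp_add, Complex.re_add_im]
  · have h := intervalIntegral.integral_eq_sub_of_hasDerivAt (a := 0) (b := Γ.period)
      (fun t _ => him t) (hqc.intervalIntegrable _ _)
    have e : Γ.rotationIndex = (1 / (2 * Real.pi)) * ∫ t in (0 : ℝ)..Γ.period,
        (deriv (deriv Γ.toFun) t / deriv Γ.toFun t).im := by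
      rw [rotationIndex]
      congr 1
      refine intervalIntegral.integral_congr fun t _ => ?_
      simp only [Complex.div_im, Complex.normSq_apply]
      rw [← sub_div]
      congr 1 <;> ring
    rw [e, h]
    have := Real.pi_pos
    field_simp
    ring
  · refine (cexp_eq_iff_re_im.1 ?_).2
    rw [hexp, hexp]
    simpa using Γ.periodic_deriv 0

theorem field_eq_norm_mul_sin {ψ : ℝ → ℝ}
    (h : ∀ t, deriv Γ.toFun t = ‖deriv Γ.toFun t‖ * Complex.exp (ψ t * Complex.I)) (R t θ : ℝ) :
    Γ.field R t θ = 1 / R * (‖deriv Γ.toFun t‖ * Real.sin (θ - ψ t)) := by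
  have hre : (deriv Γ.toFun t).re = ‖deriv Γ.toFun t‖ * Real.cos (ψ t) := by
    conv_lhs => rw [h]
    simp [Complex.exp_re]
  have him : (deriv Γ.toFun t).im = ‖deriv Γ.toFun t‖ * Real.sin (ψ t) := by
    conv_lhs => rw [h]
    simp [Complex.exp_im]
  rw [field, hre, him, Real.sin_sub]
  ring

/-- The rotation index of a star-shaped curve is `±1`: the velocity never points against the
direction of rotation about the centre, so it makes as many turns as the radius vector. -/
theorem PolarCoords.rotationIndex_eq {Γ : RegularClosedCurve} (P : Γ.PolarCoords) :
    Γ.rotationIndex = P.sgn := by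
  obtain ⟨ψ, ψ', hψ, -, hΓ, hL, n, hn⟩ := Γ.exists_tangentAngle
  have hpi := Real.pi_pos
  have hφ := P.φ_add_period 0
  rw [zero_add] at hφ
  have hs2 : (P.sgn : ℝ) * P.sgn = 1 := by rcases P.sgn_eq with h | h <;> simp [h]
  have hsin : ∀ t, 0 ≤ P.sgn * Real.sin (ψ t - P.φ t) := by
    intro t
    have e : ‖deriv Γ.toFun t‖ * Complex.exp ((ψ t - P.φ t : ℝ) * Complex.I)
        = P.r' t + P.r t * P.φ' t * Complex.I := by
      have h1 : Complex.exp (P.φ t * Complex.I) ≠ 0 := Complex.exp_ne_zero _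
      refine mul_right_cancel₀ h1 ?_
      rw [← P.deriv_eq, mul_assoc, ← Complex.exp_add, ← add_mul, ← Complex.ofReal_add,
        sub_add_cancel]
      exact (hΓ t).symm
    have e' : ‖deriv Γ.toFun t‖ * Real.sin (ψ t - P.φ t) = P.r t * P.φ' t := by
      have := congrArg Complex.im e
      rw [Complex.im_ofReal_mul, Complex.exp_ofReal_mul_I_im] at this
      simpa using this
    have hnorm : 0 < ‖deriv Γ.toFun t‖ := norm_pos_iff.2 (Γ.regular t)
    refine nonneg_of_mul_nonneg_right (a := ‖deriv Γ.toFun t‖) ?_ hnorm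
    have := mul_nonneg (P.r_pos t).le (P.sgn_mul_φ'_nonneg t)
    calc (0 : ℝ) ≤ _ := this
      _ = _ := by linear_combination -(P.sgn : ℝ) * e'
  have hc : Continuous fun t => ψ t - P.φ t :=
    continuous_iff_continuousAt.2 fun t => ((hψ t).sub (P.hasDerivAt_φ t)).continuousAt
  have hend : ψ Γ.period - P.φ Γ.period = ψ 0 - P.φ 0 + 2 * Real.pi * ((n - P.sgn : ℤ) : ℝ) := by
    rw [hn, hφ]; push_cast; ring
  -- If the two turning numbers differed, `ψ - φ` would take a value `≡ -sgn * π / 2` modulo `2π`.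
  have hbad : ∀ k : ℤ, ∀ t, ψ t - P.φ t ≠ -(P.sgn * (Real.pi / 2)) + k * (2 * Real.pi) := by
    intro k t h
    have h1 := hsin t
    rw [h, Real.sin_add_int_mul_two_pi, Real.sin_neg] at h1
    have : Real.sin (P.sgn * (Real.pi / 2)) = P.sgn := by
      rcases P.sgn_eq with h | h <;> simp [h]
    rw [this] at h1
    linarith
  have hn0 : n - P.sgn = 0 := by
    by_contra hne
    have hlen : 2 * Real.pi ≤ |2 * Real.pi * ((n - P.sgn : ℤ) : ℝ)| := by
      rw [abs_mul, abs_of_pos Real.two_pi_pos]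
      have : (1 : ℝ) ≤ |((n - P.sgn : ℤ) : ℝ)| := by exact_mod_cast Int.one_le_abs hne
      nlinarith
    set d : ℝ := 2 * Real.pi * ((n - P.sgn : ℤ) : ℝ)
    set v : ℝ := -(P.sgn * (Real.pi / 2))
    set x : ℝ := min (ψ 0 - P.φ 0) (ψ 0 - P.φ 0 + d)
    have hx : v + (-toIcoDiv Real.two_pi_pos x v : ℤ) * (2 * Real.pi) ∈
        Set.Ico x (x + 2 * Real.pi) := by
      have h1 := toIcoMod_mem_Ico Real.two_pi_pos x v
      have h2 : toIcoMod Real.two_pi_pos x v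
          = v + (-toIcoDiv Real.two_pi_pos x v : ℤ) * (2 * Real.pi) := by
        rw [toIcoMod, zsmul_eq_mul]; push_cast; ring
      rwa [h2] at h1
    have hmem : v + (-toIcoDiv Real.two_pi_pos x v : ℤ) * (2 * Real.pi)
        ∈ Set.uIcc (ψ 0 - P.φ 0) (ψ Γ.period - P.φ Γ.period) := by
      rw [hend]
      refine ⟨hx.1, hx.2.le.trans ?_⟩
      rcases le_total 0 d with h | h
      · have e1 : x = ψ 0 - P.φ 0 := min_eq_left (by linarith)
        rw [abs_of_nonneg h] at hlen
        exact le_trans (by rw [e1]; linarith) (le_max_right _ _)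
      · have e1 : x = ψ 0 - P.φ 0 + d := min_eq_right (by linarith)
        rw [abs_of_nonpos h] at hlen
        exact le_trans (by rw [e1]; linarith) (le_max_left _ _)
    obtain ⟨t, -, ht⟩ := intermediate_value_uIcc hc.continuousOn hmem
    exact hbad _ t ht
  have hn1 : (n : ℝ) = P.sgn := by exact_mod_cast sub_eq_zero.1 hn0
  rw [← hn1]
  exact mul_left_cancel₀ Real.two_pi_pos.ne' (by linarith)

/-! ### Small and large bicycles -/

theorem poincare_le_of_fence {R : ℝ} {b b' : ℝ → ℝ} (hb : ∀ t, HasDerivAt b (b' t) t)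
    (h : ∀ t ∈ Set.Ico 0 Γ.period, Γ.field R t (b t) < b' t) : Γ.poincare R (b 0) ≤ b Γ.period :=
  image_le_of_deriv_right_lt_deriv_boundary (f' := fun t => Γ.field R t (Γ.angle R (b 0) t))
    (Γ.continuous_angle R _).continuousOn
    (fun t _ => (Γ.angle_isIntegralCurve R _ t).hasDerivWithinAt) (Γ.angle_zero R _).le hb
    (fun t ht he => by rw [he]; exact h t ht) (Set.right_mem_Icc.2 Γ.period_pos.le)

theorem le_poincare_of_fence {R : ℝ} {b b' : ℝ → ℝ} (hb : ∀ t, HasDerivAt b (b' t) t)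
    (h : ∀ t ∈ Set.Ico 0 Γ.period, b' t < Γ.field R t (b t)) : b Γ.period ≤ Γ.poincare R (b 0) := by
  have := image_le_of_deriv_right_lt_deriv_boundary (a := 0) (b := Γ.period)
    (f := fun t => -Γ.angle R (b 0) t) (B := fun t => -b t) (B' := fun t => -b' t)
    (f' := fun t => -Γ.field R t (Γ.angle R (b 0) t))
    (Γ.continuous_angle R _).neg.continuousOn
    (fun t _ => (Γ.angle_isIntegralCurve R _ t).neg.hasDerivWithinAt)
    (neg_le_neg (Γ.angle_zero R _).ge) (fun t => (hb t).neg)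
    (fun t ht he => by rw [neg_inj.1 he]; exact neg_lt_neg (h t ht))
    (Set.right_mem_Icc.2 Γ.period_pos.le)
  exact neg_le_neg_iff.1 this

/-- For small `R` the arc `ψ + π / 2 ≤ θ ≤ ψ + 3π / 2` is a trapping region, so some solution turns
with the tangent. -/
theorem PolarCoords.exists_turn_of_small {Γ : RegularClosedCurve} (P : Γ.PolarCoords) :
    ∃ R₀ > 0, ∀ R, 0 < R → R ≤ R₀ → ∃ θ, Γ.poincare R θ = θ + 2 * Real.pi * P.sgn := by
  obtain ⟨ψ, ψ', hψ, hψc, hΓ, hL, -⟩ := Γ.exists_tangentAngle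
  rw [P.rotationIndex_eq] at hL
  obtain ⟨M, hM⟩ := (isCompact_Icc (a := (0 : ℝ)) (b := Γ.period)).exists_bound_of_continuousOn
    hψc.continuousOn
  obtain ⟨t₀, -, ht₀⟩ := (isCompact_Icc (a := (0 : ℝ)) (b := Γ.period)).exists_isMinOn
    ⟨0, le_rfl, Γ.period_pos.le⟩ Γ.contDiff_deriv.continuous.norm.continuousOn
  have hc : 0 < ‖deriv Γ.toFun t₀‖ := norm_pos_iff.2 (Γ.regular t₀)
  have hM0 : 0 ≤ M := (norm_nonneg _).trans (hM 0 ⟨le_rfl, Γ.period_pos.le⟩)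
  refine ⟨‖deriv Γ.toFun t₀‖ / (M + 1), by positivity, fun R hR hR₀ => ?_⟩
  have hlt : ∀ t ∈ Set.Ico 0 Γ.period, |ψ' t| < 1 / R * ‖deriv Γ.toFun t‖ := by
    intro t ht
    have ht' := Set.Ico_subset_Icc_self ht
    have h1 : ‖deriv Γ.toFun t₀‖ ≤ ‖deriv Γ.toFun t‖ := ht₀ ht'
    have h2 : |ψ' t| ≤ M := hM t ht'
    rw [le_div_iff₀ (by positivity)] at hR₀
    rw [one_div_mul_eq_div, lt_div_iff₀ hR]
    nlinarith
  have h1 := Γ.le_poincare_of_fence (R := R) (b := fun t => ψ t + Real.pi / 2)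
    (fun t => (hψ t).add_const _) fun t ht => by
      rw [Γ.field_eq_norm_mul_sin hΓ, add_sub_cancel_left, Real.sin_pi_div_two, mul_one]
      exact (le_abs_self _).trans_lt (hlt t ht)
  have h2 := Γ.poincare_le_of_fence (R := R) (b := fun t => ψ t - Real.pi / 2 + 2 * Real.pi)
    (fun t => ((hψ t).sub_const _).add_const _) fun t ht => by
      have e : ψ t - Real.pi / 2 + 2 * Real.pi - ψ t = -(Real.pi / 2) + 2 * Real.pi := by ring
      rw [Γ.field_eq_norm_mul_sin hΓ, e, Real.sin_add_two_pi, Real.sin_neg, Real.sin_pi_div_two]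
      have := hlt t ht
      linarith [neg_abs_le (ψ' t)]
  obtain ⟨θ, -, hθ⟩ := intermediate_value_uIcc (f := fun θ => Γ.poincare R θ - θ)
    (a := ψ 0 - Real.pi / 2 + 2 * Real.pi) (b := ψ 0 + Real.pi / 2)
    ((Γ.continuous_poincare R).sub continuous_id).continuousOn
    (show 2 * Real.pi * P.sgn ∈ _ from Set.mem_uIcc.2 (Or.inl ⟨by linarith, by linarith⟩))
  exact ⟨θ, by simp only at hθ; linarith⟩

/-- For large `R` no solution makes a full turn in one period. -/
theorem exists_small_advance_of_large :
    ∃ R₀ > 0, ∀ R, R₀ ≤ R → ∀ θ, |Γ.poincare R θ - θ| < 2 * Real.pi := by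
  obtain ⟨ψ, ψ', -, -, hΓ, -⟩ := Γ.exists_tangentAngle
  obtain ⟨C, hC⟩ := (isCompact_Icc (a := (0 : ℝ)) (b := Γ.period)).exists_bound_of_continuousOn
    Γ.contDiff_deriv.continuous.continuousOn
  have hC0 : 0 ≤ C := (norm_nonneg _).trans (hC 0 ⟨le_rfl, Γ.period_pos.le⟩)
  have hL := Γ.period_pos
  have hpi := Real.pi_pos
  refine ⟨C * Γ.period / Real.pi + 1, by positivity, fun R hR θ => ?_⟩
  have hR0 : 0 < R := lt_of_lt_of_le (by positivity) hR
  have h := norm_image_sub_le_of_norm_deriv_le_segment' (f := Γ.angle R θ) (a := 0) (b := Γ.period)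
    (C := C / R) (fun t _ => (Γ.angle_isIntegralCurve R θ t).hasDerivWithinAt) (fun t ht => by
      rw [Γ.field_eq_norm_mul_sin hΓ, norm_mul, norm_mul, norm_norm, Real.norm_eq_abs,
        Real.norm_eq_abs,
        abs_of_pos (one_div_pos.2 hR0), one_div_mul_eq_div]
      refine div_le_div_of_nonneg_right ?_ hR0.le
      calc _ ≤ C * 1 := mul_le_mul (hC t (Set.Ico_subset_Icc_self ht)) (Real.abs_sin_le_one _)
              (abs_nonneg _) hC0
        _ = C := mul_one C) Γ.period (Set.right_mem_Icc.2 hL.le)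
  rw [angle_zero, sub_zero, Real.norm_eq_abs] at h
  refine lt_of_le_of_lt h ?_
  rw [div_mul_eq_mul_div, div_lt_iff₀ hR0]
  have : C * Γ.period ≤ Real.pi * R := by
    have h1 : C * Γ.period / Real.pi ≤ R := by linarith
    rwa [div_le_iff₀ hpi, mul_comm R] at h1
  nlinarith [mul_pos hpi hR0]

/-! ### Monotone dependence of the advance on `R` -/

/-- For initial angles which correspond under the centring maps, shrinking `R` preserves, and makes
strict, the inequality "at least `m` turns in the direction of `sgn`". -/
theorem PolarCoords.advance_lt {Γ : RegularClosedCurve} (P : Γ.PolarCoords) {R₁ R₂ : ℝ}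
    (h₁ : 0 ≤ 1 / R₁) (h₁₂ : 1 / R₁ < 1 / R₂) {θ₁ θ₂ : ℝ}
    (h0 : P.centred R₁ 0 θ₁ = P.centred R₂ 0 θ₂) {m : ℤ}
    (hm : 2 * Real.pi * m ≤ P.sgn * (Γ.poincare R₁ θ₁ - θ₁)) :
    2 * Real.pi * m < P.sgn * (Γ.poincare R₂ θ₂ - θ₂) := by
  have h := P.centred_lt_centred h₁ h₁₂ (Γ.angle_isIntegralCurve R₁ θ₁)
    (Γ.angle_isIntegralCurve R₂ θ₂) (by rw [angle_zero, angle_zero, h0])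
  change 0 < P.sgn * (P.centred R₂ Γ.period (Γ.poincare R₂ θ₂)
    - P.centred R₁ Γ.period (Γ.poincare R₁ θ₁)) at h
  rw [centred_period, centred_period] at h
  rcases P.sgn_eq with hs | hs <;> rw [hs] at h hm ⊢ <;> push_cast at h hm ⊢
  · have h2 := P.monotone_centred R₁ 0 (show θ₁ + 2 * Real.pi * m ≤ Γ.poincare R₁ θ₁ by linarith)
    rw [centred_add_two_pi_mul, h0, ← centred_add_two_pi_mul] at h2
    have h3 := (P.monotone_centred R₂ 0).reflect_lt
      (show P.centred R₂ 0 (θ₂ + 2 * Real.pi * m) < P.centred R₂ 0 (Γ.poincare R₂ θ₂) by linarith)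
    linarith
  · have h2 := P.monotone_centred R₁ 0
      (show Γ.poincare R₁ θ₁ ≤ θ₁ + 2 * Real.pi * (-m : ℤ) by push_cast; linarith)
    rw [centred_add_two_pi_mul, h0, ← centred_add_two_pi_mul] at h2
    have h3 := (P.monotone_centred R₂ 0).reflect_lt
      (show P.centred R₂ 0 (Γ.poincare R₂ θ₂) < P.centred R₂ 0 (θ₂ + 2 * Real.pi * (-m : ℤ)) by
        linarith)
    push_cast at h3
    linarith

end RegularClosedCurve

open scoped ComplexConjugate

/-! ### The monodromy is a Möbius map -/

namespace RegularClosedCurve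

variable (Γ : RegularClosedCurve)

/-- Passing to half angles linearizes the bicycle equation: a solution `θ` is twice the argument of
a solution `u` of the real-linear equation `u' = -(1 / 2R) Γ' ū`. -/
theorem exists_spinor {R : ℝ} {θ : ℝ → ℝ} (hθ : IsIntegralCurve θ (Γ.field R)) :
    ∃ (u : ℝ → ℂ) (ρ : ℝ → ℝ), (∀ t, 0 < ρ t) ∧ ρ 0 = 1 ∧
      (∀ t, u t = ρ t * Complex.exp ((θ t / 2 : ℝ) * Complex.I)) ∧
      ∀ t, HasDerivAt u (-(1 / (2 * R) : ℝ) * deriv Γ.toFun t * conj (u t)) t := by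
  let g : ℝ → ℝ := fun t => -(1 / (2 * R)) *
    ((deriv Γ.toFun t).re * Real.cos (θ t) + (deriv Γ.toFun t).im * Real.sin (θ t))
  have hθc : Continuous θ := continuous_iff_continuousAt.2 fun t => (hθ t).continuousAt
  have hd := Γ.contDiff_deriv.continuous
  have hg : Continuous g := by fun_prop
  have hG : ∀ t, HasDerivAt (fun t => ∫ s in (0 : ℝ)..t, g s) (g t) t := fun t =>
    intervalIntegral.integral_hasDerivAt_right (hg.intervalIntegrable _ _)
      (hg.stronglyMeasurableAtFilter _ _) hg.continuousAt
  refine ⟨fun t => Real.exp (∫ s in (0 : ℝ)..t, g s) * Complex.exp ((θ t / 2 : ℝ) * Complex.I),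
    fun t => Real.exp (∫ s in (0 : ℝ)..t, g s), fun t => Real.exp_pos _, by simp, fun t => rfl,
    fun t => ?_⟩
  have h1 := (hG t).exp.ofReal_comp
  have h2 := ((((hθ t).div_const 2).ofReal_comp).mul_const Complex.I).cexp
  refine (h1.mul h2).congr_deriv ?_
  have hconj : conj (Complex.exp ((θ t / 2 : ℝ) * Complex.I))
      = Complex.exp ((θ t / 2 : ℝ) * Complex.I) * Complex.exp (-(θ t * Complex.I)) := by
    rw [← Complex.exp_conj, ← Complex.exp_add]
    congr 1
    rw [map_mul, Complex.conj_ofReal, Complex.conj_I]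
    push_cast
    ring
  have hexp : Complex.exp (-(θ t * Complex.I)) = Real.cos (θ t) - Real.sin (θ t) * Complex.I := by
    rw [← neg_mul, ← Complex.ofReal_neg, Complex.exp_mul_I, ← Complex.ofReal_cos,
      ← Complex.ofReal_sin, Real.cos_neg, Real.sin_neg]
    push_cast
    ring
  rw [map_mul, Complex.conj_ofReal, hconj, hexp]
  have hz : deriv Γ.toFun t = (deriv Γ.toFun t).re + (deriv Γ.toFun t).im * Complex.I :=
    (Complex.re_add_im _).symm
  conv_rhs => rw [hz]
  simp only [g, field]
  have h2R : (1 : ℂ) / (2 * R) = 1 / 2 * (1 / R) := by ring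
  push_cast
  rw [h2R]
  generalize (1 : ℂ) / R = q
  linear_combination (-(q / 2 * (deriv Γ.toFun t).im * Complex.sin (θ t)
    * Complex.exp (∫ s in (0 : ℝ)..t, g s : ℝ) * Complex.exp (θ t / 2 * Complex.I))) * Complex.I_sq

/-- The Wronskian of two solutions of `u' = q Γ' ū`, `q` real, is constant. -/
theorem wronskian_const {q : ℝ} {z u v : ℝ → ℂ}
    (hu : ∀ t, HasDerivAt u (q * z t * conj (u t)) t)
    (hv : ∀ t, HasDerivAt v (q * z t * conj (v t)) t) (t : ℝ) :
    (conj (u t) * v t).im = (conj (u 0) * v 0).im := by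
  have hd : ∀ t, HasDerivAt (fun t => (conj (u t) * v t).im) 0 t := by
    intro t
    have h1 : HasDerivAt (fun t => conj (u t)) (conj (q * z t * conj (u t))) t :=
      Complex.conjCLE.toContinuousLinearMap.hasFDerivAt.comp_hasDerivAt t (hu t)
    have h2 := Complex.imCLM.hasFDerivAt.comp_hasDerivAt t (h1.mul (hv t))
    refine h2.congr_deriv ?_
    simp [Complex.mul_im, Complex.mul_re]
    ring
  exact is_const_of_deriv_eq_zero (fun t => (hd t).differentiableAt) (fun t => (hd t).deriv) t 0

theorem isCircleMoebius_monodromy (R : ℝ) : IsCircleMoebius (Γ.monodromy R) := by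
  obtain ⟨u₁, ρ₁, -, h₁0, h₁, hu₁⟩ := Γ.exists_spinor (Γ.angle_isIntegralCurve R 0)
  obtain ⟨u₂, ρ₂, -, h₂0, h₂, hu₂⟩ := Γ.exists_spinor (Γ.angle_isIntegralCurve R Real.pi)
  have hq : ∀ t (u : ℝ → ℂ), -((1 / (2 * R) : ℝ) : ℂ) * deriv Γ.toFun t * conj (u t)
      = ((-(1 / (2 * R)) : ℝ) : ℂ) * deriv Γ.toFun t * conj (u t) := by
    intro t u; push_cast; ring
  simp only [hq] at hu₁ hu₂
  have e₁ : u₁ 0 = 1 := by simp [h₁, h₁0, angle_zero]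
  have e₂ : u₂ 0 = Complex.I := by
    rw [h₂, h₂0, angle_zero, Complex.ofReal_one, one_mul, Complex.ofReal_div]
    exact Complex.exp_pi_div_two_mul_I
  have hW := wronskian_const hu₁ hu₂ Γ.period
  rw [e₁, e₂] at hW
  simp only [map_one, one_mul, Complex.I_im] at hW
  set U₁ := u₁ Γ.period
  set U₂ := u₂ Γ.period
  refine ⟨(U₁ - Complex.I * U₂) / 2, (U₁ + Complex.I * U₂) / 2, ?_, fun z => ?_⟩
  · rw [← Complex.normSq_eq_norm_sq, ← Complex.normSq_eq_norm_sq]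
    simp only [Complex.mul_im, Complex.conj_re, Complex.conj_im] at hW
    simp [Complex.normSq_apply]
    linarith
  · obtain ⟨u, ρ, hρ, h0, h, hu⟩ := Γ.exists_spinor (Γ.angle_isIntegralCurve R (Complex.arg z))
    simp only [hq] at hu
    have W₁ := wronskian_const hu₁ hu Γ.period
    have W₂ := wronskian_const hu hu₂ Γ.period
    rw [e₁] at W₁
    rw [e₂] at W₂
    have hz : (z : ℂ) * conj (u 0) = u 0 := by
      have e0 : u 0 = Complex.exp ((Complex.arg z / 2 : ℝ) * Complex.I) := by
        rw [h, h0, angle_zero, Complex.ofReal_one, one_mul]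
      have ez : (z : ℂ) = Complex.exp (Complex.arg z * Complex.I) := by
        conv_lhs => rw [← Circle.exp_arg z]
        rw [Circle.coe_exp]
      rw [ez, e0, ← Complex.exp_conj, ← Complex.exp_add]
      congr 1
      rw [map_mul, Complex.conj_ofReal, Complex.conj_I]
      push_cast
      ring
    have hne0 : conj (u 0) ≠ 0 := by
      rw [Ne, map_eq_zero, h, h0]
      simp
    -- Cramer's rule: `u` is the combination of `u₁` and `u₂` with real coefficients `u 0`.
    have hlin : u Γ.period = (u 0).re * U₁ + (u 0).im * U₂ := by
      simp only [Complex.mul_im, Complex.conj_re, Complex.conj_im, Complex.one_re, Complex.one_im,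
        Complex.I_re, Complex.I_im, map_one] at hW W₁ W₂
      apply Complex.ext
      · simp
        linear_combination (-(u Γ.period).re) * hW + U₁.re * W₂ + U₂.re * W₁
      · simp
        linear_combination (-(u Γ.period).im) * hW + U₁.im * W₂ + U₂.im * W₁
    have hu0 : u 0 = (u 0).re + (u 0).im * Complex.I := (Complex.re_add_im _).symm
    have hc0 : conj (u 0) = (u 0).re - (u 0).im * Complex.I := 
      Complex.ext (by simp) (by simp)
    have hnum : ((U₁ - Complex.I * U₂) / 2 * z + (U₁ + Complex.I * U₂) / 2) * conj (u 0)
        = u Γ.period := by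
      linear_combination (U₁ - Complex.I * U₂) / 2 * hz + (U₁ - Complex.I * U₂) / 2 * hu0
        + (U₁ + Complex.I * U₂) / 2 * hc0 - hlin - U₂ * (u 0).im * Complex.I_sq
    have hden : (conj ((U₁ + Complex.I * U₂) / 2) * z + conj ((U₁ - Complex.I * U₂) / 2))
        * conj (u 0) = conj (u Γ.period) := by
      have hlin' : conj (u Γ.period) = (u 0).re * conj U₁ + (u 0).im * conj U₂ := by
        rw [hlin]; simp
      have h2 : conj (2 : ℂ) = 2 := Complex.conj_ofNat 2
      have hb : conj ((U₁ + Complex.I * U₂) / 2) = (conj U₁ - Complex.I * conj U₂) / 2 := by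
        simp [sub_eq_add_neg, h2]
      have ha : conj ((U₁ - Complex.I * U₂) / 2) = (conj U₁ + Complex.I * conj U₂) / 2 := by
        simp [h2]
      rw [hb, ha]
      linear_combination (conj U₁ - Complex.I * conj U₂) / 2 * hz
        + (conj U₁ - Complex.I * conj U₂) / 2 * hu0
        + (conj U₁ + Complex.I * conj U₂) / 2 * hc0 - hlin' - conj U₂ * (u 0).im * Complex.I_sq
    have hm : (Γ.monodromy R z : ℂ) * conj (u Γ.period) = u Γ.period := by
      rw [monodromy, Circle.coe_exp, h, map_mul, Complex.conj_ofReal, ← Complex.exp_conj,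
        mul_left_comm, ← Complex.exp_add]
      congr 2
      rw [map_mul, Complex.conj_ofReal, Complex.conj_I, poincare]
      push_cast
      ring
    have hneL : conj (u Γ.period) ≠ 0 := by
      rw [Ne, map_eq_zero, h]
      simp [(hρ _).ne']
    rw [← mul_div_mul_right _ _ hne0, hnum, hden, eq_div_iff hneL, hm]

end RegularClosedCurve

/-- A Möbius map of the circle other than the identity has at most two fixed points. -/
theorem IsCircleMoebius.encard_fixedPoints_le {f : Circle → Circle} (hf : IsCircleMoebius f)
    (hne : ∃ z, f z ≠ z) : (Function.fixedPoints f).encard ≤ 2 := by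
  obtain ⟨a, b, hab, h⟩ := hf
  have hden : ∀ z : Circle, conj b * z + conj a ≠ 0 := by
    intro z hz
    have h1 : ‖conj a‖ = ‖conj b * z‖ := by
      rw [← norm_neg, eq_neg_of_add_eq_zero_left hz]
    rw [norm_mul, Circle.norm_coe, mul_one, RCLike.norm_conj, RCLike.norm_conj] at h1
    rw [h1] at hab
    simp at hab
  have hfix : ∀ z : Circle, f z = z ↔ conj b * z ^ 2 + (conj a - a) * z - b = 0 := by
    intro z
    rw [← Circle.coe_inj, h z, div_eq_iff (hden z), ← sub_eq_zero, ← neg_eq_zero]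
    have e : -(a * z + b - z * (conj b * z + conj a))
        = conj b * (z : ℂ) ^ 2 + (conj a - a) * z - b := by ring
    rw [e]
  by_contra hlt
  obtain ⟨t, ht, h3⟩ := Set.exists_subset_encard_eq (k := 3) (s := Function.fixedPoints f)
    (by have := Order.add_one_le_of_lt (not_le.1 hlt); norm_num at this; exact this)
  obtain ⟨x, y, z, hxy, hxz, hyz, rfl⟩ := Set.encard_eq_three.1 h3
  have hx := (hfix x).1 (ht (by simp))
  have hy := (hfix y).1 (ht (by simp))
  have hz := (hfix z).1 (ht (by simp))
  -- Divided differences of the quadratic polynomial successively kill its coefficients.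
  have h1 : conj b * (x + y) + (conj a - a) = 0 := by
    refine mul_left_cancel₀ (sub_ne_zero.2 (Circle.coe_inj.not.2 hxy)) ?_
    linear_combination hx - hy
  have h2 : conj b * (x + z) + (conj a - a) = 0 := by
    refine mul_left_cancel₀ (sub_ne_zero.2 (Circle.coe_inj.not.2 hxz)) ?_
    linear_combination hx - hz
  have hb : conj b = 0 := by
    refine mul_left_cancel₀ (sub_ne_zero.2 (Circle.coe_inj.not.2 hyz)) ?_
    linear_combination h1 - h2
  have hb' : b = 0 := (map_eq_zero _).1 hb
  obtain ⟨w, hw⟩ := hne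
  refine hw ((hfix w).2 ?_)
  rw [hb, zero_mul, zero_add] at h1
  rw [hb, h1, hb']
  simp

namespace RegularClosedCurve

variable {Γ : RegularClosedCurve}

/-- The fixed points of the monodromy are the angles which advance by full turns. -/
theorem exp_mem_fixedPoints_iff {R θ : ℝ} :
    Circle.exp θ ∈ Function.fixedPoints (Γ.monodromy R) ↔
      ∃ m : ℤ, Γ.poincare R θ = θ + 2 * Real.pi * m := by
  rw [Function.mem_fixedPoints_iff, monodromy_exp, Circle.exp_eq_exp]
  simp only [mul_comm]

/-! ### The first plateau -/

namespace PolarCoords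

theorem advance_eq_iff (P : Γ.PolarCoords) (R θ : ℝ) :
    P.sgn * (Γ.poincare R θ - θ) = 2 * Real.pi ↔ Γ.poincare R θ = θ + 2 * Real.pi * P.sgn := by
  have hs2 : (P.sgn : ℝ) * P.sgn = 1 := by rcases P.sgn_eq with h | h <;> simp [h]
  refine ⟨fun h => ?_, fun h => ?_⟩
  · linear_combination P.sgn * h - (Γ.poincare R θ - θ) * hs2
  · rw [h]; linear_combination 2 * Real.pi * hs2

/-- The rotation number equals the rotation index exactly when some solution makes one turn. -/
theorem rotationNumber_eq_iff (P : Γ.PolarCoords) (R : ℝ) :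
    Γ.rotationNumber R = Γ.rotationIndex ↔
      ∃ θ, P.sgn * (Γ.poincare R θ - θ) = 2 * Real.pi := by
  simp only [P.rotationIndex_eq, rotationNumber_eq_int_iff, P.advance_eq_iff]

theorem continuous_advance (P : Γ.PolarCoords) (R : ℝ) :
    Continuous fun θ => P.sgn * (Γ.poincare R θ - θ) :=
  continuous_const.mul ((Γ.continuous_poincare R).sub continuous_id)

theorem rotationNumber_eq_of_le_of_le (P : Γ.PolarCoords) {R θ₁ θ₂ : ℝ}
    (h₁ : 2 * Real.pi ≤ P.sgn * (Γ.poincare R θ₁ - θ₁))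
    (h₂ : P.sgn * (Γ.poincare R θ₂ - θ₂) ≤ 2 * Real.pi) :
    Γ.rotationNumber R = Γ.rotationIndex := by
  obtain ⟨θ, -, hθ⟩ := intermediate_value_uIcc (P.continuous_advance R).continuousOn
    (Set.mem_uIcc.2 (Or.inl ⟨h₂, h₁⟩))
  exact (P.rotationNumber_eq_iff R).2 ⟨θ, hθ⟩

/-- At least one turn at `R₁` forces more than one turn, for some initial angle, at `R₂ < R₁`. -/
theorem exists_two_pi_lt (P : Γ.PolarCoords) {R₁ R₂ θ₁ : ℝ} (h₂ : 0 < R₂) (h : R₂ < R₁)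
    (hθ : 2 * Real.pi ≤ P.sgn * (Γ.poincare R₁ θ₁ - θ₁)) :
    ∃ θ₂, 2 * Real.pi < P.sgn * (Γ.poincare R₂ θ₂ - θ₂) := by
  obtain ⟨θ₂, e⟩ := P.surjective_centred R₂ 0 (P.centred R₁ 0 θ₁)
  have := P.advance_lt (one_div_nonneg.2 (h₂.trans h).le)
    (one_div_lt_one_div_of_lt h₂ h) e.symm (m := 1) (by simpa using hθ)
  exact ⟨θ₂, by simpa using this⟩

/-- At most one turn at `R₂` forces less than one turn, for some initial angle, at `R₁ > R₂`. -/
theorem exists_lt_two_pi (P : Γ.PolarCoords) {R₁ R₂ θ₂ : ℝ} (h₂ : 0 < R₂) (h : R₂ < R₁)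
    (hθ : P.sgn * (Γ.poincare R₂ θ₂ - θ₂) ≤ 2 * Real.pi) :
    ∃ θ₁, P.sgn * (Γ.poincare R₁ θ₁ - θ₁) < 2 * Real.pi := by
  obtain ⟨θ₁, e⟩ := P.surjective_centred R₁ 0 (P.centred R₂ 0 θ₂)
  refine ⟨θ₁, lt_of_not_ge fun hge => ?_⟩
  have := P.advance_lt (one_div_nonneg.2 (h₂.trans h).le)
    (one_div_lt_one_div_of_lt h₂ h) e (m := 1) (by simpa using hge)
  simp only [Int.cast_one, mul_one] at this
  linarith

/-- Every solution advances strictly in the direction of `sgn`: compare with the stationary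
solutions for `R = ∞`. -/
theorem advance_pos (P : Γ.PolarCoords) {R : ℝ} (hR : 0 < R) (θ : ℝ) :
    0 < P.sgn * (Γ.poincare R θ - θ) := by
  have hst : ∀ θ₁, Γ.poincare 0 θ₁ = θ₁ := fun θ₁ => congrFun
    (Γ.integralCurve_unique 0 (Γ.angle_isIntegralCurve 0 θ₁) (β := fun _ => θ₁) (t₀ := 0)
      (fun t => by simpa [field] using hasDerivAt_const t θ₁) (Γ.angle_zero 0 θ₁)) Γ.period
  obtain ⟨θ₁, e⟩ := P.surjective_centred 0 0 (P.centred R 0 θ)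
  simpa using P.advance_lt (R₁ := 0) (by simp) (by simpa using hR) e (m := 0) (by simp [hst])

/-- An advance of less than one turn is not a whole number of turns. -/
theorem not_full_turns (P : Γ.PolarCoords) {R θ : ℝ} (hR : 0 < R)
    (h2 : P.sgn * (Γ.poincare R θ - θ) < 2 * Real.pi) {m : ℤ} :
    Γ.poincare R θ ≠ θ + 2 * Real.pi * m := by
  intro hm
  have h1 := P.advance_pos hR θ
  rw [hm, add_sub_cancel_left] at h1 h2
  have hpi := Real.two_pi_pos
  have h3 : (0 : ℝ) < (P.sgn * m : ℤ) := by
    push_cast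
    exact pos_of_mul_pos_right (a := 2 * Real.pi) (by linarith) hpi.le
  have h4 : ((P.sgn * m : ℤ) : ℝ) < 1 := by
    push_cast
    exact lt_of_mul_lt_mul_left (a := 2 * Real.pi) (by linarith) hpi.le
  have h5 : 0 < P.sgn * m := by exact_mod_cast h3
  have h6 : P.sgn * m < 1 := by exact_mod_cast h4
  omega

theorem nonempty_firstPlateau (P : Γ.PolarCoords) : Γ.firstPlateau.Nonempty := by
  obtain ⟨R₀, hR₀, h⟩ := P.exists_turn_of_small
  refine ⟨R₀, hR₀, fun R hR => ?_⟩
  rw [P.rotationIndex_eq, rotationNumber_eq_int_iff]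
  exact h R hR.1 hR.2

theorem bddAbove_firstPlateau (P : Γ.PolarCoords) : BddAbove Γ.firstPlateau := by
  obtain ⟨R₀, -, h⟩ := Γ.exists_small_advance_of_large
  refine ⟨R₀, fun R hR => le_of_not_gt fun hlt => ?_⟩
  obtain ⟨θ, hθ⟩ := (P.rotationNumber_eq_iff R).1 (hR.2 R ⟨hR.1, le_rfl⟩)
  have h1 := h R hlt.le θ
  rw [abs_lt] at h1
  rcases P.sgn_eq with hs | hs <;> rw [hs] at hθ <;> push_cast at hθ <;> linarith [h1.1, h1.2]

theorem isLUB_criticalBLength (P : Γ.PolarCoords) : IsLUB Γ.firstPlateau Γ.criticalBLength :=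
  isLUB_csSup P.nonempty_firstPlateau P.bddAbove_firstPlateau

theorem isHyperbolic_of_lt (P : Γ.PolarCoords) {R : ℝ} (hR : 0 < R) (h : R < Γ.criticalBLength) :
    IsHyperbolic (Γ.monodromy R) := by
  obtain ⟨Rs, hRs, hlt⟩ := exists_lt_of_lt_csSup P.nonempty_firstPlateau h
  have hpi := Real.two_pi_pos
  obtain ⟨θ₁, hθ₁⟩ := (P.rotationNumber_eq_iff Rs).1 (hRs.2 Rs ⟨hRs.1, le_rfl⟩)
  obtain ⟨x, hx⟩ := P.exists_two_pi_lt hR hlt hθ₁.ge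
  obtain ⟨θ₂, hθ₂⟩ := (P.rotationNumber_eq_iff (R / 2)).1
    (hRs.2 (R / 2) ⟨by linarith, by linarith⟩)
  obtain ⟨y₀, hy₀⟩ := P.exists_lt_two_pi (by linarith) (by linarith : R / 2 < R) hθ₂.le
  have hper : ∀ (θ : ℝ) (n : ℤ), P.sgn * (Γ.poincare R (θ + 2 * Real.pi * n)
      - (θ + 2 * Real.pi * n)) = P.sgn * (Γ.poincare R θ - θ) := by
    intro θ n
    rw [poincare_add_two_pi_mul]
    ring
  -- Move `y₀` into the period starting at `x`.
  obtain ⟨y, hy, hxy⟩ : ∃ y, P.sgn * (Γ.poincare R y - y) < 2 * Real.pi ∧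
      y ∈ Set.Ico x (x + 2 * Real.pi) := by
    refine ⟨toIcoMod hpi x y₀, ?_, toIcoMod_mem_Ico hpi x y₀⟩
    have e : toIcoMod hpi x y₀ = y₀ + 2 * Real.pi * (-toIcoDiv hpi x y₀ : ℤ) := by
      rw [toIcoMod, zsmul_eq_mul]; push_cast; ring
    rwa [e, hper]
  have hx' : 2 * Real.pi < P.sgn * (Γ.poincare R (x + 2 * Real.pi) - (x + 2 * Real.pi)) := by
    have := hper x 1
    simp only [Int.cast_one, mul_one] at this
    rwa [this]
  have hc := P.continuous_advance R
  obtain ⟨p, hp, hpv⟩ := intermediate_value_Ioo' hxy.1 hc.continuousOn ⟨hy, hx⟩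
  obtain ⟨q, hq, hqv⟩ := intermediate_value_Ioo hxy.2.le hc.continuousOn ⟨hy, hx'⟩
  have hfix : ∀ θ, P.sgn * (Γ.poincare R θ - θ) = 2 * Real.pi →
      Circle.exp θ ∈ Function.fixedPoints (Γ.monodromy R) := fun θ hθ =>
    exp_mem_fixedPoints_iff.2 ⟨P.sgn, (P.advance_eq_iff R θ).1 hθ⟩
  have hpq : Circle.exp p ≠ Circle.exp q := fun he =>
    (hp.2.trans hq.1).ne (Circle.exp_injOn_Icc (a := p) (b := q) (by linarith [hp.1, hq.2])
      ⟨le_rfl, (hp.2.trans hq.1).le⟩ ⟨(hp.2.trans hq.1).le, le_rfl⟩ he)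
  have hM := Γ.isCircleMoebius_monodromy R
  refine ⟨hM, le_antisymm (hM.encard_fixedPoints_le ?_) ?_⟩
  · -- The advance takes values strictly between `0` and `2π`.
    refine ⟨Circle.exp y, fun hyf => ?_⟩
    obtain ⟨m, hm⟩ := exp_mem_fixedPoints_iff.1 hyf
    exact P.not_full_turns hR hy hm
  · have := Order.add_one_le_of_lt (Set.one_lt_encard_iff.2 ⟨_, _, hfix p hpv, hfix q hqv, hpq⟩)
    norm_num at this
    exact this

theorem isElliptic_of_gt (P : Γ.PolarCoords) {R : ℝ} (h : Γ.criticalBLength < R) :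
    IsElliptic (Γ.monodromy R) := by
  refine ⟨Γ.isCircleMoebius_monodromy R, Set.eq_empty_of_forall_notMem fun z hz => ?_⟩
  obtain ⟨Rs, hRs⟩ := P.nonempty_firstPlateau
  have hc : 0 < Γ.criticalBLength := hRs.1.trans_le (P.isLUB_criticalBLength.1 hRs)
  have hR : 0 < R := hc.trans h
  obtain ⟨R₁, hR₁, hR₁R⟩ := exists_between h
  -- A full turn at `R` would extend the plateau up to `R₁`.
  have hlt : ∀ θ, P.sgn * (Γ.poincare R θ - θ) < 2 * Real.pi := by
    intro θ
    by_contra! hge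
    refine not_lt_of_ge (P.isLUB_criticalBLength.1 ⟨hc.trans hR₁, fun R' hR' => ?_⟩) hR₁
    obtain ⟨x, hx⟩ := P.exists_two_pi_lt hR'.1 (hR'.2.trans_lt hR₁R) hge
    rcases le_or_gt R' Rs with hle | hgt
    · exact hRs.2 R' ⟨hR'.1, hle⟩
    · obtain ⟨θ₂, hθ₂⟩ := (P.rotationNumber_eq_iff Rs).1 (hRs.2 Rs ⟨hRs.1, le_rfl⟩)
      obtain ⟨y, hy⟩ := P.exists_lt_two_pi hRs.1 hgt hθ₂.le
      exact P.rotationNumber_eq_of_le_of_le hx.le hy.le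
  rw [← Circle.exp_arg z] at hz
  obtain ⟨m, hm⟩ := exp_mem_fixedPoints_iff.1 hz
  exact P.not_full_turns hR (hlt _) hm

end PolarCoords

end RegularClosedCurve

theorem mainTheorem2 (Γ : RegularClosedCurve) (hΓ : Γ.IsStarShaped) :
    (0 < Γ.criticalBLength ∧ IsLUB Γ.firstPlateau Γ.criticalBLength) ∧
    (∀ R : ℝ, 0 < R → R < Γ.criticalBLength → IsHyperbolic (Γ.monodromy R)) ∧
    (∀ R : ℝ, Γ.criticalBLength < R → IsElliptic (Γ.monodromy R)) := by
  obtain ⟨P⟩ := hΓ.exists_polarCoords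
  obtain ⟨R, hR⟩ := P.nonempty_firstPlateau
  exact ⟨⟨hR.1.trans_le (P.isLUB_criticalBLength.1 hR), P.isLUB_criticalBLength⟩,
    fun _ => P.isHyperbolic_of_lt, fun _ => P.isElliptic_of_gt⟩
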